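/- Let $k\ge 1$ be an integer, let $\mathbb T=\{z\in\mathbb C:|z|=1\}$, and let $P^k_+=\{(\lambda_1,\lambda_2)\in\mathbb Z_{\ge0}^2:\lambda_1+2\lambda_2\le k\}$ with distinguished vertex $*=(0,0)$. On $\mathbb T^2$ put $$\chi_1=1+2\,\mathrm{Re}(\omega_1+\omega_2+\omega_1\omega_2^{-1}),\qquad \chi_2=\chi_1+1+2\,\mathrm{Re}(\omega_1\omega_2+\omega_1^2\omega_2^{-1}+\omega_1\omega_2^{-2}),$$ the characters of the fundamental representations $\rho_1,\rho_2$ of $G_2$ of dimension $7$ and $14$, and $$J=8\pi^2\,\mathrm{Re}(\omega_1^2\omega_2+\omega_1\omega_2^{-3}+\omega_1^3\omega_2^{-2}-\omega_1\omega_2^2-\omega_1^3\omega_2^{-1}-\omega_1^2\omega_2^{-3}).$$ Let $W\subset GL(2,\mathbb Z)$ be the Weyl group of $G_2$, the dihedral group of order $12$ generated by $\begin{pmatrix}0&-1\\-1&0\end{pmatrix}$ and $\begin{pmatrix}0&1\\-1&1\end{pmatrix}$, acting on $\mathbb T^2$ by $(\omega_1,\omega_2)\mapsto(\omega_1^{a_{11}}\omega_2^{a_{12}},\omega_1^{a_{21}}\omega_2^{a_{22}})$.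 The fusion graphs $\mathcal A^{\rho_1}_k(G_2)$, $\mathcal A^{\rho_2}_k(G_2)$ have vertex set $P^k_+$. With $l$ the unilateral shift on $\ell^2(\mathbb Z_{\ge0})$, the adjacency matrix of the first is the compression to $\ell^2(P^k_+)$ of $$ll^*\otimes1+l\otimes1+l^*\otimes1+l^*\otimes l+l\otimes l^*+l^2\otimes l^*+(l^*)^2\otimes l,$$ (the McKay graph of $\rho_1$) and that of the second is the compression to $\ell^2(P^k_+)$ of $$ll^*\otimes1+l^2l^*\otimes1+l(l^*)^2\otimes1+l(l^*)^2\otimes l+l^2l^*\otimes l^*+l^2\otimes l^*+(l^*)^2\otimes l+1\otimes ll^*+1\otimes l+1\otimes l^*+l^3\otimes l^*+(l^*)^3\otimes l+l^3\otimes(l^*)^2+(l^*)^3\otimes l^2$$ (the McKay graph of $\rho_2$), with one self-loop removed at each vertex with $\lambda_1+2\lambda_2=k$. Let $\Delta_1,\Delta_2$ be these adjacency matrices, acting on $\ell^2(P^k_+)$, and $\Omega$ the basis vector of $*$. A joint spectral measure of $\Delta_1,\Delta_2$ over $\mathbb T^2$ is a $W$-invariant Borel measure $\varepsilon$ on $\mathbb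 T^2$ whose image under $(\chi_1,\chi_2)$ is a probability measure $\tilde\nu$ on the joint spectrum of $\Delta_1,\Delta_2$ with $\langle\Delta_1^m\Delta_2^n\Omega,\Omega\rangle=\int x^my^n\,d\tilde\nu(x,y)$ for all $m,n\ge0$. Then: (1) $\Delta_1,\Delta_2$ are commuting and self-adjoint, and there is exactly one joint spectral measure over $\mathbb T^2$, namely $$d\varepsilon(\omega_1,\omega_2)=\frac{1}{192\pi^4}\,J(\omega_1,\omega_2)^2\,d^{(k+4)}(\omega_1,\omega_2),$$ where $d^{(k+4)}$ is the uniform probability measure on the set of the $3(k+4)^2$ points $(e^{2\pi iq_1/3(k+4)},e^{2\pi iq_2/3(k+4)})$ with $q_1,q_2\in\{0,\dots,3k+11\}$ and $q_1+q_2\equiv0\bmod 3$. (2) With $\omega_j=e^{2\pi i\theta_j}$, $J$ is up to sign the Jacobian of the characters, $J=-\det\bigl(\partial(\chi_1,\chi_2)/\partial(\theta_1,\theta_2)\bigr)$, and $$J=256\pi^2\sin(\pi\theta_1)\sin(\pi\theta_2)\sin(\pi(\theta_1+\theta_2))\sin(\pi(\theta_1-\theta_2))\sin(\pi(2\theta_1-\theta_2))\sin(\pi(\theta_1-2\theta_2)).$$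 (3) For $\lambda,\mu\in\mathbb Z_{\ge0}^2$ put $\xi=\pi/3(k+4)$, $a=\lambda_1+\lambda_2+2$, $b=\lambda_2+1$, $c=\mu_1+\mu_2+2$, $d=\mu_2+1$ and $$S_{\lambda,\mu}=\frac{-2}{(k+4)\sqrt3}\bigl[\cos2\xi(2ac+ad+bc+2bd)+\cos2\xi(-ac-2ad+bc-bd)+\cos2\xi(-ac+ad-2bc-bd)-\cos2\xi(-ac-2ad-2bc-bd)-\cos2\xi(2ac+ad+bc-bd)-\cos2\xi(-ac+ad+bc+2bd)\bigr]$$ (the Kac–Peterson $S$-matrix of $G_2$ at level $k$). The matrix $(S_{\lambda,\mu})_{\lambda,\mu\in P^k_+}$ is orthogonal, the graphs are given by the Verlinde formula $$(\Delta_j)_{\mu,\nu}=\sum_{\sigma\in P^k_+}\frac{S_{\sigma,\rho_j}}{S_{\sigma,(0,0)}}\,S_{\sigma,\mu}S_{\sigma,\nu},\qquad \rho_1=(1,0),\ \rho_2=(0,1),$$ and for all $\lambda\in P^k_+$, with $J$ written in the angles $\theta_1,\theta_2$, $$S_{\lambda,(0,0)}=\frac{-1}{4\sqrt3\,(k+4)\pi^2}\;J\!\left(\frac{(\lambda_1+1)+3(\lambda_2+1)}{3(k+4)},\,\frac{-(\lambda_1+1)}{3(k+4)}\right).$$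 -/

import Mathlib

open MeasureTheory ProbabilityTheory

/-! ### Joint spectral measures of commuting self-adjoint operators -/

/-- The joint spectrum of two operators `a`, `b` on a finite-dimensional Hilbert space: the pairs of
real joint eigenvalues. -/
def jointSpectrum {H : Type*} [NormedAddCommGroup H] [InnerProductSpace ℂ H]
    (a b : H →L[ℂ] H) : Set (ℝ × ℝ) :=
  {p | ∃ v : H, v ≠ 0 ∧ a v = (p.1 : ℂ) • v ∧ b v = (p.2 : ℂ) • v}

/-- `ν` is the joint spectral measure of the commuting self-adjoint operators `a`, `b` on a
finite-dimensional Hilbert space, for the vector state `φ(T) = ⟨T Ω, Ω⟩` (linear in `T`): a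
probability measure on the joint spectrum with cross moments `φ(a ^ m * b ^ n)`. -/
structure IsJointSpectralMeasure {H : Type*} [NormedAddCommGroup H] [InnerProductSpace ℂ H]
    [FiniteDimensional ℂ H] [CompleteSpace H] (a b : H →L[ℂ] H) (Ω : H)
    (ν : Measure (ℝ × ℝ)) : Prop where
  selfAdjoint_left : IsSelfAdjoint a
  selfAdjoint_right : IsSelfAdjoint b
  commute : Commute a b
  norm_vector : ‖Ω‖ = 1
  isProbability : IsProbabilityMeasure ν
  supported : ∀ᵐ p ∂ν, p ∈ jointSpectrum a b
  moments : ∀ m n : ℕ,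
    inner ℂ Ω ((a ^ m * b ^ n) Ω) = ((∫ p, p.1 ^ m * p.2 ^ n ∂ν : ℝ) : ℂ)

/-! ### The maximal torus of `G₂`, its Weyl group, characters and Jacobian -/

noncomputable instance circleMeasurableSpace : MeasurableSpace Circle := borel Circle

instance circleBorelSpace : BorelSpace Circle := ⟨rfl⟩

/-- The Weyl group of `G₂`: the dihedral group of order 12 in `GL(2, ℤ)` generated by the matrices
`(0, -1; -1, 0)` and `(0, 1; -1, 1)`. -/
def weylGroup : Subgroup (GL (Fin 2) ℤ) :=
  Subgroup.closure
    {⟨!![0, -1; -1, 0], !![0, -1; -1, 0], by decide, by decide⟩,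
      ⟨!![0, 1; -1, 1], !![1, -1; 1, 0], by decide, by decide⟩}

/-- The action of an integer matrix on the torus,
`(ω₁, ω₂) ↦ (ω₁ ^ g₁₁ * ω₂ ^ g₁₂, ω₁ ^ g₂₁ * ω₂ ^ g₂₂)`. -/
noncomputable def torusAction (g : GL (Fin 2) ℤ) (ω : Circle × Circle) : Circle × Circle :=
  (ω.1 ^ g.1 0 0 * ω.2 ^ g.1 0 1, ω.1 ^ g.1 1 0 * ω.2 ^ g.1 1 1)

/-- Real part of the character `ω₁ ^ a * ω₂ ^ b` of the torus. -/
noncomputable def reChar (a b : ℤ) (ω : Circle × Circle) : ℝ :=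
  ((ω.1 ^ a * ω.2 ^ b : Circle) : ℂ).re

/-- The character of the 7-dimensional fundamental representation of `G₂`, on the torus. -/
noncomputable def chi₁ (ω : Circle × Circle) : ℝ :=
  1 + 2 * reChar 1 0 ω + 2 * reChar 0 1 ω + 2 * reChar 1 (-1) ω

/-- The character of the 14-dimensional (adjoint) representation of `G₂`, on the torus. -/
noncomputable def chi₂ (ω : Circle × Circle) : ℝ :=
  chi₁ ω + 1 + 2 * reChar 1 1 ω + 2 * reChar 2 (-1) ω + 2 * reChar 1 (-2) ω

/-- The function `J` on the torus (up to sign, the Jacobian of `(chi₁, chi₂)` with respect to the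
angles). -/
noncomputable def jacobian (ω : Circle × Circle) : ℝ :=
  8 * Real.pi ^ 2 * (reChar 2 1 ω + reChar 1 (-3) ω + reChar 3 (-2) ω
    - reChar 1 2 ω - reChar 3 (-1) ω - reChar 2 (-3) ω)

/-- The point `e ^ (2 π i θ)` of the circle. -/
noncomputable def circleAt (θ : ℝ) : Circle := Circle.exp (2 * Real.pi * θ)

/-- `ε` is the joint spectral measure over the torus of the operators `a`, `b` in the vector state of
`Ω`: it is invariant under the Weyl group, and its image under `(chi₁, chi₂)` is the joint spectral
measure of `a`, `b`. -/
structure IsJointSpectralMeasureOverTorus {H : Type*} [NormedAddCommGroup H]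
    [InnerProductSpace ℂ H] [FiniteDimensional ℂ H] [CompleteSpace H] (a b : H →L[ℂ] H) (Ω : H)
    (ε : Measure (Circle × Circle)) : Prop where
  invariant : ∀ g ∈ weylGroup, ε.map (torusAction g) = ε
  pushforward : IsJointSpectralMeasure a b Ω (ε.map fun ω => (chi₁ ω, chi₂ ω))

/-! ### The graphs of level `k` -/

/-- The vertices at level `k`: Dynkin labels `(l₁, l₂)`, `l₁, l₂ ≥ 0`, with `l₁ + 2 l₂ ≤ k`. Here
`(1, 0)` is the 7-dimensional and `(0, 1)` the 14-dimensional representation. -/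
def alcove (k : ℕ) : Finset (ℕ × ℕ) :=
  (Finset.range (k + 1) ×ˢ Finset.range (k + 1)).filter fun l => l.1 + 2 * l.2 ≤ k

/-- The distinguished vertex `(0, 0)`, i.e. the trivial representation. -/
def vacuum (k : ℕ) : alcove k := ⟨(0, 0), by simp [alcove]⟩

/-- Matrix entry from `x` to `y` of the operator `l ^ m (l*) ^ p ⊗ l ^ n (l*) ^ q` on
`ℓ²(ℕ) ⊗ ℓ²(ℕ)`, where `l` is the unilateral shift: one edge from `x` to
`x + (m - p, n - q)` provided `x.1 ≥ p` and `x.2 ≥ q`. -/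
def shiftEntry (m p n q : ℕ) (x y : ℕ × ℕ) : ℕ :=
  if p ≤ x.1 ∧ q ≤ x.2 ∧ y = (x.1 - p + m, x.2 - q + n) then 1 else 0

/-- The McKay graph of the 7-dimensional representation of `G₂`: the number of edges from `x` to `y`,
i.e. the multiplicity of the irreducible representation `y` in the tensor product of `x` with it. -/
def mcKay₁ (x y : ℕ × ℕ) : ℕ :=
  shiftEntry 1 1 0 0 x y + shiftEntry 1 0 0 0 x y + shiftEntry 0 1 0 0 x y
    + shiftEntry 0 1 1 0 x y + shiftEntry 1 0 0 1 x y
    + shiftEntry 2 0 0 1 x y + shiftEntry 0 2 1 0 x y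

/-- The McKay graph of the 14-dimensional representation of `G₂`. -/
def mcKay₂ (x y : ℕ × ℕ) : ℕ :=
  shiftEntry 1 1 0 0 x y + shiftEntry 2 1 0 0 x y + shiftEntry 1 2 0 0 x y
    + shiftEntry 1 2 1 0 x y + shiftEntry 2 1 0 1 x y
    + shiftEntry 2 0 0 1 x y + shiftEntry 0 2 1 0 x y
    + shiftEntry 0 0 1 1 x y + shiftEntry 0 0 1 0 x y + shiftEntry 0 0 0 1 x y
    + shiftEntry 3 0 0 1 x y + shiftEntry 0 3 1 0 x y
    + shiftEntry 3 0 0 2 x y + shiftEntry 0 3 2 0 x y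

/-- Adjacency matrix of the fusion graph at level `k` of the 7-dimensional representation: the McKay
graph restricted to the vertices of level `k`. -/
def fusionGraph₁ (k : ℕ) : Matrix (alcove k) (alcove k) ℕ :=
  Matrix.of fun x y => mcKay₁ x y

/-- Adjacency matrix of the fusion graph at level `k` of the 14-dimensional representation: the McKay
graph restricted to the vertices of level `k`, with one self-loop removed at each vertex of the cut-off
line `x₁ + 2 x₂ = k`. (For `k ≥ 1` such a vertex is not `(0, 0)`, so it does have a self-loop.) -/
def fusionGraph₂ (k : ℕ) : Matrix (alcove k) (alcove k) ℕ :=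
  Matrix.of fun x y => mcKay₂ x y - (if x = y ∧ x.1.1 + 2 * x.1.2 = k then 1 else 0)

/-- The operator on `ℓ²` of the vertex set given by an adjacency matrix. -/
noncomputable def adjacencyOperator {V : Type*} [Fintype V] [DecidableEq V] (A : Matrix V V ℕ) :
    EuclideanSpace ℂ V →L[ℂ] EuclideanSpace ℂ V :=
  Matrix.toEuclideanCLM (n := V) (𝕜 := ℂ) (A.map fun n : ℕ => (n : ℂ))

/-- The Kac–Peterson modular `S`-matrix of `G₂` at level `k`, in Dynkin labels. -/
noncomputable def kacPetersonS (k : ℕ) (l m : ℕ × ℕ) : ℝ :=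
  let ξ : ℝ := Real.pi / (3 * (k + 4))
  let a : ℝ := (l.1 + 1) + (l.2 + 1)
  let b : ℝ := l.2 + 1
  let c : ℝ := (m.1 + 1) + (m.2 + 1)
  let d : ℝ := m.2 + 1;
  (-2 : ℝ) / ((k + 4) * Real.sqrt 3) *
    (Real.cos (2 * ξ * (2 * (a * c) + a * d + b * c + 2 * (b * d)))
      + Real.cos (2 * ξ * (-(a * c) - 2 * (a * d) + b * c - b * d))
      + Real.cos (2 * ξ * (-(a * c) + a * d - 2 * (b * c) - b * d))
      - Real.cos (2 * ξ * (-(a * c) - 2 * (a * d) - 2 * (b * c) - b * d))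
      - Real.cos (2 * ξ * (2 * (a * c) + a * d + b * c - b * d))
      - Real.cos (2 * ξ * (-(a * c) + a * d + b * c + 2 * (b * d))))

/-- The `S`-matrix at level `k`, on the vertices of level `k`. -/
noncomputable def sMatrix (k : ℕ) : Matrix (alcove k) (alcove k) ℝ :=
  Matrix.of fun l m => kacPetersonS k l m

/-- The matrix `N_l = ∑_σ (S_{σ,l} / S_{σ,0}) S_σ S_σ*` of fusion with `l` given by the Verlinde
formula. -/
noncomputable def verlindeMatrix (k : ℕ) (l : ℕ × ℕ) : Matrix (alcove k) (alcove k) ℝ :=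
  Matrix.of fun x y => ∑ σ : alcove k,
    kacPetersonS k σ l / kacPetersonS k σ (0, 0) * (kacPetersonS k σ x * kacPetersonS k σ y)

/-! ### The discrete measure -/

/-- The points `(e ^ (2 π i q₁ / 3(k+4)), e ^ (2 π i q₂ / 3(k+4)))` of the torus with
`0 ≤ q₁, q₂ ≤ 3 k + 11` and `q₁ + q₂ ≡ 0 mod 3`. -/
def torusPoints (k : ℕ) : Set (Circle × Circle) :=
  {ω | ∃ q₁ q₂ : ℕ, q₁ ≤ 3 * k + 11 ∧ q₂ ≤ 3 * k + 11 ∧ q₁ + q₂ ≡ 0 [MOD 3] ∧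
    ω = (circleAt (q₁ / (3 * (k + 4))), circleAt (q₂ / (3 * (k + 4))))}

/-- The measure `J² d^{(k+4)} / (192 π⁴)`, where `d^{(k+4)}` is the uniform probability measure on
`torusPoints k`. -/
noncomputable def discreteMeasure (k : ℕ) : Measure (Circle × Circle) :=
  (uniformOn (torusPoints k)).withDensity fun ω =>
    ENNReal.ofReal (jacobian ω ^ 2 / (192 * Real.pi ^ 4))

/-! ### Angles on the torus -/

/-! The proof rests on the alternating sums `altSum k x y`, half the sum over the Weyl group of ±
exp(2πi⟨wx,y⟩/(k+4)). As a function of y such a sum changes sign under every reflection of the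
affine Weyl group of level k, so it vanishes on the walls. Multiplying it by χ₁ or χ₂ at the torus
point of x adds up its translates by the weights of the representation, because the Weyl group
permutes these weights. For y in the alcove, a translate that leaves the alcove lands on a wall or
is reflected back in with a minus sign. This accounts exactly for the edges missing from the
compressed McKay graphs and for the removed self-loops (`sum_edgeValue_seven`,
`sum_edgeValue_fourteen`). Hence the columns of S are joint eigenvectors of the two graphs, with the
values of χ₁, χ₂ at the weight points as eigenvalues.

Orthogonality of S needs a single inner product. The joint eigenvalues are distinct, so the
symmetric matrix S² commutes with enough diagonal matrices to be diagonal, and it is scalar because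
the vacuum row of S has no zero (`mul_self_eq_smul_one_of_simple_joint_spectrum`). The scalar is ∑
S_{x,0}², a multiple of the sum of J² over the alcove, which orthogonality of characters on the
finite grid evaluates to give 1. From S² = 1 follow Δ_j = S D_j S with D_j diagonal, the joint
spectrum, and the moments with weights S_{x,0}². The Verlinde formula follows with the Weyl
character formula S_{x,ρ_j} = χ_j S_{x,0}.

The grid carrying the measure consists of points on walls, where J = 0, and of twelve Weyl copies of
the shifted alcove (`sum_grid_eq_nsmul_sum_alcove`). So the image of the discrete measure under (χ₁,
χ₂) has mass S_{x,0}² at the eigenvalue of x, as the moments demand.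

For uniqueness, moments determine a measure on a finite set, and a Weyl-invariant measure on the
torus can be recovered from its image because every fibre of (χ₁, χ₂) is one finite orbit. The last
fact uses SU(3) ⊂ G₂: if t is the trace in the 3-dimensional representation, then χ₁ = 1 + 2 Re t
and |t|² = χ₂ - χ₁ + 2, so t is known up to conjugation, and the trace of an element of SU(3)
determines its eigenvalues. The same argument shows that the joint eigenvalues are distinct. -/

lemma circleAt_add (s t : ℝ) : circleAt (s + t) = circleAt s * circleAt t := by
  rw [circleAt, mul_add, Circle.exp_add]; rfl

lemma circleAt_zpow (s : ℝ) (m : ℤ) : circleAt s ^ m = circleAt (m * s) := by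
  rw [circleAt, circleAt, ← Circle.exp_zsmul, zsmul_eq_mul]
  congr 1; ring

lemma circleAt_neg (s : ℝ) : circleAt (-s) = (circleAt s)⁻¹ := by
  simpa using (circleAt_zpow s (-1)).symm

lemma coe_circleAt (s : ℝ) :
    (circleAt s : ℂ) = Real.cos (2 * Real.pi * s) + Real.sin (2 * Real.pi * s) * Complex.I := by
  rw [circleAt, Circle.coe_exp, Complex.exp_mul_I]; push_cast; rfl

lemma circleAt_surjective : Function.Surjective circleAt := by
  intro z
  refine ⟨Complex.arg z / (2 * Real.pi), ?_⟩
  rw [circleAt, mul_div_cancel₀ _ (by positivity), Circle.exp_arg]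

lemma exists_circleAt_pair (ω : Circle × Circle) : ∃ s t, ω = (circleAt s, circleAt t) := by
  obtain ⟨s, hs⟩ := circleAt_surjective ω.1
  obtain ⟨t, ht⟩ := circleAt_surjective ω.2
  exact ⟨s, t, by rw [hs, ht]⟩

lemma circleAt_eq_iff {s t : ℝ} : circleAt s = circleAt t ↔ ∃ m : ℤ, s = t + m := by
  rw [circleAt, circleAt, Circle.exp_eq_exp]
  constructor
  · rintro ⟨m, hm⟩
    refine ⟨m, ?_⟩
    have : 2 * Real.pi * (s - (t + m)) = 0 := by linear_combination hm
    have h2 : (2 * Real.pi) ≠ 0 := by positivity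
    have := (mul_eq_zero.mp this).resolve_left h2
    linarith
  · rintro ⟨m, rfl⟩
    exact ⟨m, by ring⟩

lemma reChar_circleAt (a b : ℤ) (s t : ℝ) :
    reChar a b (circleAt s, circleAt t) = Real.cos (2 * Real.pi * (a * s + b * t)) := by
  rw [reChar, circleAt_zpow, circleAt_zpow, ← circleAt_add, circleAt, Circle.coe_exp,
    Complex.exp_ofReal_mul_I_re]

lemma chi₁_circleAt (s t : ℝ) : chi₁ (circleAt s, circleAt t) =
    1 + 2 * Real.cos (2 * Real.pi * s) + 2 * Real.cos (2 * Real.pi * t)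
      + 2 * Real.cos (2 * Real.pi * (s - t)) := by
  simp only [chi₁, reChar_circleAt]
  push_cast
  ring_nf

lemma chi₂_circleAt (s t : ℝ) : chi₂ (circleAt s, circleAt t) =
    chi₁ (circleAt s, circleAt t) + 1 + 2 * Real.cos (2 * Real.pi * (s + t))
      + 2 * Real.cos (2 * Real.pi * (2 * s - t)) + 2 * Real.cos (2 * Real.pi * (s - 2 * t)) := by
  simp only [chi₂, reChar_circleAt]
  push_cast
  ring_nf

lemma jacobian_circleAt (s t : ℝ) : jacobian (circleAt s, circleAt t) =
    8 * Real.pi ^ 2 * (Real.cos (2 * Real.pi * (2 * s + t)) + Real.cos (2 * Real.pi * (s - 3 * t))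
      + Real.cos (2 * Real.pi * (3 * s - 2 * t)) - Real.cos (2 * Real.pi * (s + 2 * t))
      - Real.cos (2 * Real.pi * (3 * s - t)) - Real.cos (2 * Real.pi * (2 * s - 3 * t))) := by
  simp only [jacobian, reChar_circleAt]
  push_cast
  ring_nf

/-! ### The Jacobian determinant and its product formula -/

lemma hasDerivAt_cos_two_pi (a b x : ℝ) :
    HasDerivAt (fun t => 2 * Real.cos (2 * Real.pi * (a * t + b)))
      (-(4 * Real.pi * a) * Real.sin (2 * Real.pi * (a * x + b))) x := by
  have h : HasDerivAt (fun t : ℝ => 2 * Real.pi * (a * t + b)) (2 * Real.pi * a) x := by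
    simpa using (((hasDerivAt_id x).const_mul a).add_const b).const_mul (2 * Real.pi)
  exact (h.cos.const_mul 2).congr_deriv (by ring)

lemma deriv_chi₁_left (s t : ℝ) : deriv (fun x => chi₁ (circleAt x, circleAt t)) s =
    -(4 * Real.pi) * (Real.sin (2 * Real.pi * s) + Real.sin (2 * Real.pi * (s - t))) := by
  have h := ((hasDerivAt_cos_two_pi 1 0 s).add (hasDerivAt_cos_two_pi 1 (-t) s)).add_const
    (1 + 2 * Real.cos (2 * Real.pi * t))
  refine (HasDerivAt.congr_deriv (h.congr_of_eventuallyEq (.of_forall fun x => ?_)) ?_).deriv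
  · simp only [chi₁_circleAt, Pi.add_apply]; ring_nf
  · ring_nf

lemma deriv_chi₁_right (s t : ℝ) : deriv (fun x => chi₁ (circleAt s, circleAt x)) t =
    -(4 * Real.pi) * (Real.sin (2 * Real.pi * t) - Real.sin (2 * Real.pi * (s - t))) := by
  have h := ((hasDerivAt_cos_two_pi 1 0 t).add (hasDerivAt_cos_two_pi (-1) s t)).add_const
    (1 + 2 * Real.cos (2 * Real.pi * s))
  refine (HasDerivAt.congr_deriv (h.congr_of_eventuallyEq (.of_forall fun x => ?_)) ?_).deriv
  · simp only [chi₁_circleAt, Pi.add_apply]; ring_nf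
  · ring_nf

lemma differentiableAt_chi₁_left (s t : ℝ) :
    DifferentiableAt ℝ (fun x => chi₁ (circleAt x, circleAt t)) s := by
  simp only [chi₁_circleAt]; fun_prop

lemma differentiableAt_chi₁_right (s t : ℝ) :
    DifferentiableAt ℝ (fun x => chi₁ (circleAt s, circleAt x)) t := by
  simp only [chi₁_circleAt]; fun_prop

lemma deriv_chi₂_left (s t : ℝ) : deriv (fun x => chi₂ (circleAt x, circleAt t)) s =
    deriv (fun x => chi₁ (circleAt x, circleAt t)) s
    - (4 * Real.pi) * (Real.sin (2 * Real.pi * (s + t)) + 2 * Real.sin (2 * Real.pi * (2 * s - t))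
      + Real.sin (2 * Real.pi * (s - 2 * t))) := by
  have h := ((((differentiableAt_chi₁_left s t).hasDerivAt.add (hasDerivAt_cos_two_pi 1 t s)).add
    (hasDerivAt_cos_two_pi 2 (-t) s)).add (hasDerivAt_cos_two_pi 1 (-2 * t) s)).add_const 1
  refine (HasDerivAt.congr_deriv (h.congr_of_eventuallyEq (.of_forall fun x => ?_)) ?_).deriv
  · simp only [chi₂_circleAt, Pi.add_apply]; ring_nf
  · ring_nf

lemma deriv_chi₂_right (s t : ℝ) : deriv (fun x => chi₂ (circleAt s, circleAt x)) t =
    deriv (fun x => chi₁ (circleAt s, circleAt x)) t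
    - (4 * Real.pi) * (Real.sin (2 * Real.pi * (s + t)) - Real.sin (2 * Real.pi * (2 * s - t))
      - 2 * Real.sin (2 * Real.pi * (s - 2 * t))) := by
  have h := ((((differentiableAt_chi₁_right s t).hasDerivAt.add (hasDerivAt_cos_two_pi 1 s t)).add
    (hasDerivAt_cos_two_pi (-1) (2 * s) t)).add (hasDerivAt_cos_two_pi (-2) s t)).add_const 1
  refine (HasDerivAt.congr_deriv (h.congr_of_eventuallyEq (.of_forall fun x => ?_)) ?_).deriv
  · simp only [chi₂_circleAt, Pi.add_apply]; ring_nf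
  · ring_nf

lemma sin_mul_sin_eq (x y : ℝ) :
    Real.sin x * Real.sin y = (Real.cos (x - y) - Real.cos (x + y)) / 2 := by
  rw [Real.cos_sub, Real.cos_add]; ring

lemma cos_mul_cos_eq (x y : ℝ) :
    Real.cos x * Real.cos y = (Real.cos (x - y) + Real.cos (x + y)) / 2 := by
  rw [Real.cos_sub, Real.cos_add]; ring

lemma jacobian_eq_neg_det (s t : ℝ) :
    jacobian (circleAt s, circleAt t) = -(Matrix.det
        !![deriv (fun x => chi₁ (circleAt x, circleAt t)) s,
           deriv (fun x => chi₁ (circleAt s, circleAt x)) t;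
           deriv (fun x => chi₂ (circleAt x, circleAt t)) s,
           deriv (fun x => chi₂ (circleAt s, circleAt x)) t]) := by
  rw [Matrix.det_fin_two_of, deriv_chi₂_left, deriv_chi₂_right, deriv_chi₁_left, deriv_chi₁_right,
    jacobian_circleAt]
  -- In the rescaled angles every argument is an integer combination of x and y, so the identity
  -- becomes linear in cosines after each product of sines is expanded.
  obtain ⟨x, rfl⟩ : ∃ x, s = x / (2 * Real.pi) := ⟨2 * Real.pi * s, by field_simp⟩
  obtain ⟨y, rfl⟩ : ∃ y, t = y / (2 * Real.pi) := ⟨2 * Real.pi * t, by field_simp⟩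
  have h : ∀ a b : ℝ, 2 * Real.pi * (a * (x / (2 * Real.pi)) + b * (y / (2 * Real.pi)))
      = a * x + b * y := by intro a b; field_simp
  have e1 := h 1 0; have e2 := h 0 1; have e3 := h 1 (-1); have e4 := h 1 1; have e5 := h 2 (-1)
  have e6 := h 1 (-2); have e7 := h 2 1; have e8 := h 1 (-3); have e9 := h 3 (-2)
  have e10 := h 1 2; have e11 := h 3 (-1); have e12 := h 2 (-3)
  simp only [one_mul, zero_mul, neg_mul, add_zero, zero_add, ← sub_eq_add_neg] at e1 e2 e3 e4 e5 e6 e7 e8 e9 e10 e11 e12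
  rw [e1, e2, e3, e4, e5, e6, e7, e8, e9, e10, e11, e12]
  have p : ∀ a b c d : ℝ, b - a = c → a + b = d →
      Real.sin a * Real.sin b = (Real.cos c - Real.cos d) / 2 := by
    rintro a b _ _ rfl rfl
    rw [mul_comm, sin_mul_sin_eq, add_comm]
  have m : ∀ a b c d : ℝ, a - b = c → a + b = d →
      Real.sin a * Real.sin b = (Real.cos c - Real.cos d) / 2 := by
    rintro a b _ _ rfl rfl
    rw [sin_mul_sin_eq]
  have q1 := p x (x + y) y (2 * x + y) (by ring) (by ring)
  have q2 := p x (2 * x - y) (x - y) (3 * x - y) (by ring) (by ring)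
  have q3 := m x (x - 2 * y) (2 * y) (2 * x - 2 * y) (by ring) (by ring)
  have q4 := p y (x + y) x (x + 2 * y) (by ring) (by ring)
  have q5 := p y (2 * x - y) (2 * x - 2 * y) (2 * x) (by ring) (by ring)
  have q6 := p y (x - 2 * y) (x - 3 * y) (x - y) (by ring) (by ring)
  have q7 := p (x - y) (x + y) (2 * y) (2 * x) (by ring) (by ring)
  have q8 := p (x - y) (2 * x - y) x (3 * x - 2 * y) (by ring) (by ring)
  have q9 := m (x - y) (x - 2 * y) y (2 * x - 3 * y) (by ring) (by ring)
  linear_combination (16 * Real.pi ^ 2) * (q1 - q2 - 2 * q3 + q7 - q8 - 2 * q9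
    - (q4 + 2 * q5 + q6) + (q7 + 2 * q8 + q9))

/-- The Weyl denominator formula of G₂: an alternating sum over the Weyl group factors over the six
positive roots. -/
lemma jacobian_eq_prod_sin (s t : ℝ) :
    jacobian (circleAt s, circleAt t) = 256 * Real.pi ^ 2 *
        (Real.sin (Real.pi * s) * Real.sin (Real.pi * t) * Real.sin (Real.pi * (s + t)) *
          Real.sin (Real.pi * (s - t)) * Real.sin (Real.pi * (2 * s - t)) *
          Real.sin (Real.pi * (s - 2 * t))) := by
  rw [jacobian_circleAt]
  set x := Real.pi * s with hx
  set y := Real.pi * t with hy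
  have e1 : Real.pi * (s + t) = x + y := by rw [hx, hy]; ring
  have e2 : Real.pi * (s - t) = x - y := by rw [hx, hy]; ring
  have e3 : Real.pi * (2 * s - t) = 2 * x - y := by rw [hx, hy]; ring
  have e4 : Real.pi * (s - 2 * t) = x - 2 * y := by rw [hx, hy]; ring
  have f1 : 2 * Real.pi * (2 * s + t) = 4 * x + 2 * y := by rw [hx, hy]; ring
  have f2 : 2 * Real.pi * (s - 3 * t) = 2 * x - 6 * y := by rw [hx, hy]; ring
  have f3 : 2 * Real.pi * (3 * s - 2 * t) = 6 * x - 4 * y := by rw [hx, hy]; ring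
  have f4 : 2 * Real.pi * (s + 2 * t) = 2 * x + 4 * y := by rw [hx, hy]; ring
  have f5 : 2 * Real.pi * (3 * s - t) = 6 * x - 2 * y := by rw [hx, hy]; ring
  have f6 : 2 * Real.pi * (2 * s - 3 * t) = 4 * x - 6 * y := by rw [hx, hy]; ring
  rw [e1, e2, e3, e4, f1, f2, f3, f4, f5, f6]
  -- In p = exp(ix) and q = exp(iy) both sides are Laurent polynomials. The six sines contribute the
  -- factor (i/2)⁶ = -1/64.
  have key : ∀ x y : ℂ, Complex.cos (4 * x + 2 * y) + Complex.cos (2 * x - 6 * y)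
      + Complex.cos (6 * x - 4 * y) - Complex.cos (2 * x + 4 * y) - Complex.cos (6 * x - 2 * y)
      - Complex.cos (4 * x - 6 * y) = 32 * (Complex.sin x * Complex.sin y * Complex.sin (x + y) *
        Complex.sin (x - y) * Complex.sin (2 * x - y) * Complex.sin (x - 2 * y)) := by
    intro x y
    have hp : ∀ (a b : ℤ), Complex.exp ((a * x + b * y) * Complex.I)
        = Complex.exp (x * Complex.I) ^ a * Complex.exp (y * Complex.I) ^ b := by
      intro a b
      rw [← Complex.exp_int_mul, ← Complex.exp_int_mul, ← Complex.exp_add]; ring_nf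
    have hp0 := Complex.exp_ne_zero (x * Complex.I)
    have hq0 := Complex.exp_ne_zero (y * Complex.I)
    have hc : ∀ (a b : ℤ), Complex.cos (a * x + b * y) =
        (Complex.exp (x * Complex.I) ^ a * Complex.exp (y * Complex.I) ^ b
        + Complex.exp (x * Complex.I) ^ (-a) * Complex.exp (y * Complex.I) ^ (-b)) / 2 := by
      intro a b
      rw [Complex.cos, ← hp, ← hp]; push_cast; ring_nf
    have hs : ∀ (a b : ℤ), Complex.sin (a * x + b * y) =
        (Complex.exp (x * Complex.I) ^ (-a) * Complex.exp (y * Complex.I) ^ (-b)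
        - Complex.exp (x * Complex.I) ^ a * Complex.exp (y * Complex.I) ^ b) * Complex.I / 2 := by
      intro a b
      rw [Complex.sin, ← hp, ← hp]; push_cast; ring_nf
    have c1 := hc 4 2; have c2 := hc 2 (-6); have c3 := hc 6 (-4); have c4 := hc 2 4
    have c5 := hc 6 (-2); have c6 := hc 4 (-6)
    have s1 := hs 1 0; have s2 := hs 0 1; have s3 := hs 1 1; have s4 := hs 1 (-1)
    have s5 := hs 2 (-1); have s6 := hs 1 (-2)
    push_cast at c1 c2 c3 c4 c5 c6 s1 s2 s3 s4 s5 s6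
    simp only [one_mul, zero_mul, neg_mul, add_zero, zero_add, ← sub_eq_add_neg, neg_zero,
      zpow_zero, mul_one] at c1 c2 c3 c4 c5 c6 s1 s2 s3 s4 s5 s6
    rw [c1, c2, c3, c4, c5, c6, s1, s2, s3, s4, s5, s6]
    generalize Complex.exp (x * Complex.I) = p at *
    generalize Complex.exp (y * Complex.I) = q at *
    clear c1 c2 c3 c4 c5 c6 s1 s2 s3 s4 s5 s6 hc hs hp
    have hI : Complex.I ^ 6 = -1 := by
      rw [show (6 : ℕ) = 2 * 3 by norm_num, pow_mul, Complex.I_sq]; norm_num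
    have hI2 : ∀ a b c d e f : ℂ, (a * Complex.I / 2) * (b * Complex.I / 2) * (c * Complex.I / 2)
      * (d * Complex.I / 2) * (e * Complex.I / 2) * (f * Complex.I / 2) = - (a * b * c * d * e * f) / 64 := by
      intro a b c d e f
      linear_combination (a * b * c * d * e * f) / 64 * hI
    rw [hI2]
    simp only [zpow_neg, zpow_ofNat]
    field_simp
    ring
  have := key (x : ℂ) (y : ℂ)
  have h : Real.cos (4 * x + 2 * y) + Real.cos (2 * x - 6 * y)
      + Real.cos (6 * x - 4 * y) - Real.cos (2 * x + 4 * y) - Real.cos (6 * x - 2 * y)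
      - Real.cos (4 * x - 6 * y) = 32 * (Real.sin x * Real.sin y * Real.sin (x + y) *
        Real.sin (x - y) * Real.sin (2 * x - y) * Real.sin (x - 2 * y)) := by
    exact_mod_cast this
  rw [h]; ring

/-! ### The action of the Weyl group -/

lemma torusAction_circleAt (g : GL (Fin 2) ℤ) (s t : ℝ) :
    torusAction g (circleAt s, circleAt t) =
      (circleAt (g.1 0 0 * s + g.1 0 1 * t), circleAt (g.1 1 0 * s + g.1 1 1 * t)) := by
  simp only [torusAction, circleAt_zpow, circleAt_add]

lemma torusAction_mul (g h : GL (Fin 2) ℤ) (ω : Circle × Circle) :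
    torusAction (g * h) ω = torusAction g (torusAction h ω) := by
  obtain ⟨s, t, rfl⟩ := exists_circleAt_pair ω
  simp only [torusAction_circleAt, Units.val_mul, Matrix.mul_apply, Fin.sum_univ_two, Int.cast_add,
    Int.cast_mul]
  congr 2 <;> ring

lemma torusAction_one (ω : Circle × Circle) : torusAction 1 ω = ω := by
  simp [torusAction]

lemma torusAction_inv_apply (g : GL (Fin 2) ℤ) (ω : Circle × Circle) :
    torusAction g⁻¹ (torusAction g ω) = ω := by
  rw [← torusAction_mul, inv_mul_cancel, torusAction_one]

lemma continuous_torusAction (g : GL (Fin 2) ℤ) : Continuous (torusAction g) := by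
  unfold torusAction
  fun_prop

lemma measurable_torusAction (g : GL (Fin 2) ℤ) : Measurable (torusAction g) :=
  (continuous_torusAction g).measurable

lemma continuous_reChar (a b : ℤ) : Continuous (reChar a b) := by
  unfold reChar
  exact Complex.continuous_re.comp (continuous_subtype_val.comp (by fun_prop))

lemma measurable_chi : Measurable fun ω : Circle × Circle => (chi₁ ω, chi₂ ω) := by
  have h := continuous_reChar
  have h1 : Continuous chi₁ := by
    unfold chi₁
    fun_prop
  have h2 : Continuous chi₂ := by
    unfold chi₂
    fun_prop
  exact (h1.prodMk h2).measurable

/-- Two points of the torus lie in the same orbit of the Weyl group. -/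
def WeylRel (ω ω' : Circle × Circle) : Prop := ∃ g ∈ weylGroup, torusAction g ω = ω'

lemma WeylRel.trans {x y z : Circle × Circle} (h : WeylRel x y) (h' : WeylRel y z) :
    WeylRel x z := by
  obtain ⟨g, hg, rfl⟩ := h
  obtain ⟨g', hg', rfl⟩ := h'
  exact ⟨g' * g, mul_mem hg' hg, torusAction_mul _ _ _⟩

lemma WeylRel.refl (x : Circle × Circle) : WeylRel x x := ⟨1, one_mem _, torusAction_one x⟩

lemma WeylRel.swap (a b : Circle) : WeylRel (a, b) (b⁻¹, a⁻¹) :=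
  ⟨_, Subgroup.subset_closure (Set.mem_insert _ _), by simp [torusAction]⟩

lemma WeylRel.rotate (a b : Circle) : WeylRel (a, b) (b, a⁻¹ * b) :=
  ⟨_, Subgroup.subset_closure (Set.mem_insert_of_mem _ rfl), by simp [torusAction]⟩

/-- Induction over the Weyl group for properties closed under composition. -/
lemma weylGroup_induction {p : GL (Fin 2) ℤ → Prop} (one : p 1)
    (mul : ∀ g h, p g → p h → p (g * h)) (inv : ∀ g, p g → p g⁻¹)
    (swap : ∀ g, (∀ a b, torusAction g (a, b) = (b⁻¹, a⁻¹)) → p g)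
    (rotate : ∀ g, (∀ a b, torusAction g (a, b) = (b, a⁻¹ * b)) → p g)
    {g : GL (Fin 2) ℤ} (hg : g ∈ weylGroup) : p g := by
  induction hg using Subgroup.closure_induction with
  | mem x hx =>
    rcases hx with rfl | rfl
    · exact swap _ fun a b => by simp [torusAction]
    · exact rotate _ fun a b => by simp [torusAction]
  | one => exact one
  | mul x y _ _ hx hy => exact mul x y hx hy
  | inv x _ hx => exact inv x hx

/-! ### Behaviour of the characters and of J under the two generators -/

lemma chi₁_swap (a b : Circle) : chi₁ (b⁻¹, a⁻¹) = chi₁ (a, b) := by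
  obtain ⟨s, rfl⟩ := circleAt_surjective a
  obtain ⟨t, rfl⟩ := circleAt_surjective b
  rw [← circleAt_neg, ← circleAt_neg, chi₁_circleAt, chi₁_circleAt, mul_neg, mul_neg, Real.cos_neg,
    Real.cos_neg]
  ring_nf

lemma chi₁_rotate (a b : Circle) : chi₁ (b, a⁻¹ * b) = chi₁ (a, b) := by
  obtain ⟨s, rfl⟩ := circleAt_surjective a
  obtain ⟨t, rfl⟩ := circleAt_surjective b
  rw [← circleAt_neg, ← circleAt_add, chi₁_circleAt, chi₁_circleAt,
    show 2 * Real.pi * (-s + t) = -(2 * Real.pi * (s - t)) by ring, Real.cos_neg]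
  ring_nf

lemma chi₂_swap (a b : Circle) : chi₂ (b⁻¹, a⁻¹) = chi₂ (a, b) := by
  have h := chi₁_swap a b
  obtain ⟨s, rfl⟩ := circleAt_surjective a
  obtain ⟨t, rfl⟩ := circleAt_surjective b
  rw [← circleAt_neg, ← circleAt_neg] at h ⊢
  rw [chi₂_circleAt, chi₂_circleAt, h,
    show 2 * Real.pi * (-t + -s) = -(2 * Real.pi * (s + t)) by ring, Real.cos_neg]
  ring_nf

lemma chi₂_rotate (a b : Circle) : chi₂ (b, a⁻¹ * b) = chi₂ (a, b) := by
  have h := chi₁_rotate a b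
  obtain ⟨s, rfl⟩ := circleAt_surjective a
  obtain ⟨t, rfl⟩ := circleAt_surjective b
  rw [← circleAt_neg, ← circleAt_add] at h ⊢
  rw [chi₂_circleAt, chi₂_circleAt, h,
    show 2 * Real.pi * (t + (-s + t)) = -(2 * Real.pi * (s - 2 * t)) by ring, Real.cos_neg,
    show 2 * Real.pi * (t - 2 * (-s + t)) = 2 * Real.pi * (2 * s - t) by ring]
  ring_nf

lemma jacobian_swap (a b : Circle) : jacobian (b⁻¹, a⁻¹) = -jacobian (a, b) := by
  obtain ⟨s, rfl⟩ := circleAt_surjective a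
  obtain ⟨t, rfl⟩ := circleAt_surjective b
  rw [← circleAt_neg, ← circleAt_neg, jacobian_eq_prod_sin, jacobian_eq_prod_sin, mul_neg, mul_neg,
    Real.sin_neg, Real.sin_neg, show Real.pi * (-t + -s) = -(Real.pi * (s + t)) by ring,
    Real.sin_neg, show Real.pi * (-t - -s) = Real.pi * (s - t) by ring,
    show Real.pi * (2 * -t - -s) = Real.pi * (s - 2 * t) by ring,
    show Real.pi * (-t - 2 * -s) = Real.pi * (2 * s - t) by ring]
  ring

lemma jacobian_rotate (a b : Circle) : jacobian (b, a⁻¹ * b) = jacobian (a, b) := by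
  obtain ⟨s, rfl⟩ := circleAt_surjective a
  obtain ⟨t, rfl⟩ := circleAt_surjective b
  rw [← circleAt_neg, ← circleAt_add, jacobian_eq_prod_sin, jacobian_eq_prod_sin,
    show Real.pi * (-s + t) = -(Real.pi * (s - t)) by ring,
    show Real.pi * (t + (-s + t)) = -(Real.pi * (s - 2 * t)) by ring,
    show Real.pi * (t - (-s + t)) = Real.pi * s by ring,
    show Real.pi * (2 * t - (-s + t)) = Real.pi * (s + t) by ring,
    show Real.pi * (t - 2 * (-s + t)) = Real.pi * (2 * s - t) by ring,
    Real.sin_neg, Real.sin_neg]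
  ring

/-! ### The characters separate the orbits -/

/-- The rotation has order six and its cube is -1. -/
lemma WeylRel.neg (a b : Circle) : WeylRel (a, b) (a⁻¹, b⁻¹) := by
  have h := ((WeylRel.rotate a b).trans (WeylRel.rotate _ _)).trans (WeylRel.rotate _ _)
  convert h using 2
  · simp
  · simp [mul_comm]

/-- The eigenvalues `z₁, z₂, (z₁ z₂)⁻¹` in `SU(3)` of a torus element are determined, up to order, by
their sum. -/
lemma circle_triple_of_sum_eq {z₁ z₂ w₁ w₂ : Circle}
    (h : (z₁ : ℂ) + z₂ + ((z₁ * z₂)⁻¹ : Circle) = w₁ + w₂ + ((w₁ * w₂)⁻¹ : Circle)) :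
    (w₁ = z₁ ∧ w₂ = z₂) ∨ (w₁ = z₁ ∧ w₂ = (z₁ * z₂)⁻¹) ∨ (w₁ = z₂ ∧ w₂ = z₁) ∨
      (w₁ = z₂ ∧ w₂ = (z₁ * z₂)⁻¹) ∨ (w₁ = (z₁ * z₂)⁻¹ ∧ w₂ = z₁) ∨
      (w₁ = (z₁ * z₂)⁻¹ ∧ w₂ = z₂) := by
  have hc := congrArg (starRingEnd ℂ) h
  simp only [map_add, ← Circle.coe_inv_eq_conj, inv_inv] at hc
  have nz : ∀ z : Circle, (z : ℂ) ≠ 0 := Circle.coe_ne_zero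
  have n1 := nz z₁; have n2 := nz z₂; have n3 := nz w₁; have n4 := nz w₂
  simp only [← Circle.coe_inj]
  push_cast at h hc ⊢
  generalize (z₁ : ℂ) = a at *
  generalize (z₂ : ℂ) = b at *
  generalize (w₁ : ℂ) = c at *
  generalize (w₂ : ℂ) = d at *
  -- On the circle, conjugating the sum gives the sum of inverses, which is the second elementary
  -- symmetric function when the product is 1. Both triples are therefore the roots of one cubic.
  have h3 : (c - a) * (c - b) * (c - (a * b)⁻¹) = 0 := by
    have e : a * b + b * (a * b)⁻¹ + a * (a * b)⁻¹ = c * d + d * (c * d)⁻¹ + c * (c * d)⁻¹ := by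
      have e1 : b * (a * b)⁻¹ = a⁻¹ := by field_simp
      have e2 : a * (a * b)⁻¹ = b⁻¹ := by field_simp
      have e3 : d * (c * d)⁻¹ = c⁻¹ := by field_simp
      have e4 : c * (c * d)⁻¹ = d⁻¹ := by field_simp
      rw [e1, e2, e3, e4]
      linear_combination hc
    have p1 : a * b * (a * b)⁻¹ = 1 := by field_simp
    have p2 : c * d * (c * d)⁻¹ = 1 := by field_simp
    linear_combination (-c ^ 2) * h + c * e - p1 + p2
  have h4 : (c = a ∧ (d - b) * (d - (a * b)⁻¹) = 0) ∨ (c = b ∧ (d - a) * (d - (a * b)⁻¹) = 0) ∨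
      (c = (a * b)⁻¹ ∧ (d - a) * (d - b) = 0) := by
    rcases mul_eq_zero.mp h3 with h3 | h3
    · rcases mul_eq_zero.mp h3 with h3 | h3
      · left
        obtain rfl := sub_eq_zero.mp h3
        refine ⟨rfl, ?_⟩
        have p1 : c * b * (c * b)⁻¹ = 1 := by field_simp
        have p2 : c * d * (c * d)⁻¹ = 1 := by field_simp
        have : c * ((d - b) * (d - (c * b)⁻¹)) = 0 := by linear_combination (-c * d) * h + p1 - p2
        exact (mul_eq_zero.mp this).resolve_left n3
      · right; left
        obtain rfl := sub_eq_zero.mp h3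
        refine ⟨rfl, ?_⟩
        have p1 : a * c * (a * c)⁻¹ = 1 := by field_simp
        have p2 : c * d * (c * d)⁻¹ = 1 := by field_simp
        have : c * ((d - a) * (d - (a * c)⁻¹)) = 0 := by linear_combination (-c * d) * h + p1 - p2
        exact (mul_eq_zero.mp this).resolve_left n3
    · right; right
      have h3 := sub_eq_zero.mp h3
      refine ⟨h3, ?_⟩
      have p1 : c * (a * b) = 1 := by rw [h3]; field_simp
      have p2 : c * d * (c * d)⁻¹ = 1 := by field_simp
      rw [← h3] at h
      have : c * ((d - a) * (d - b)) = 0 := by linear_combination (-c * d) * h + p1 - p2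
      exact (mul_eq_zero.mp this).resolve_left n3
  simp only [mul_eq_zero, sub_eq_zero] at h4
  tauto

/-- The left side is |t|² for the trace t in the 3-dimensional representation of SU(3). The identity
reflects 3 ⊗ 3̄ = 1 + 8 together with the restrictions 7 = 1 + 3 + 3̄ and 14 = 8 + 3 + 3̄. -/
lemma normSq_circle_triple (s t : ℝ) :
    (Real.cos (2 * Real.pi * s) + Real.cos (2 * Real.pi * t) + Real.cos (2 * Real.pi * (s - t))) ^ 2 +
    (Real.sin (2 * Real.pi * s) - Real.sin (2 * Real.pi * t) - Real.sin (2 * Real.pi * (s - t))) ^ 2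
      = chi₂ (circleAt s, circleAt t) - chi₁ (circleAt s, circleAt t) + 2 := by
  rw [chi₂_circleAt, show 2 * Real.pi * (s + t) = 2 * Real.pi * s + 2 * Real.pi * t by ring,
    show 2 * Real.pi * (2 * s - t) = 2 * Real.pi * s + 2 * Real.pi * (s - t) by ring,
    show 2 * Real.pi * (s - 2 * t) = 2 * Real.pi * (s - t) - 2 * Real.pi * t by ring,
    Real.cos_add, Real.cos_add, Real.cos_sub]
  linear_combination Real.sin_sq_add_cos_sq (2 * Real.pi * s) +
    Real.sin_sq_add_cos_sq (2 * Real.pi * t) + Real.sin_sq_add_cos_sq (2 * Real.pi * (s - t))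

/-- The trace of a torus element in the 3-dimensional representation of `SU(3)`. -/
noncomputable def tripleSum (ω : Circle × Circle) : ℂ :=
  (ω.1 : ℂ) + (ω.2⁻¹ : Circle) + ((ω.1 * ω.2⁻¹)⁻¹ : Circle)

/-- Equal traces mean that the two eigenvalue triples agree up to one of six permutations. The swap
is a transposition of the triple and the square of the rotation a 3-cycle, so all six permutations
come from the Weyl group. -/
lemma weylRel_of_tripleSum_eq {ω ω' : Circle × Circle} (h : tripleSum ω = tripleSum ω') :
    WeylRel ω ω' := by
  obtain ⟨a, b⟩ := ω
  obtain ⟨c, d⟩ := ω'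
  have hsw := (WeylRel.swap a b)
  have hcyc := ((WeylRel.rotate a b).trans (WeylRel.rotate _ _))
  have hcyc2 := hcyc.trans ((WeylRel.rotate _ _).trans (WeylRel.rotate _ _))
  have hh := circle_triple_of_sum_eq h
  simp only [inv_eq_iff_eq_inv, inv_inv] at hh
  rcases hh with ⟨rfl, rfl⟩ | ⟨rfl, rfl⟩ | ⟨rfl, rfl⟩ | ⟨rfl, rfl⟩ | ⟨rfl, rfl⟩ | ⟨rfl, rfl⟩
  · exact WeylRel.refl _
  · convert hcyc.trans (WeylRel.swap _ _) using 2
    · simp [mul_comm]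
    · simp [mul_comm]
  · exact hsw
  · convert hcyc2 using 2
    · simp
    · simp [mul_comm]
  · convert hcyc using 2
    · simp [mul_comm]
    · simp [mul_comm]
  · convert hcyc2.trans (WeylRel.swap _ _) using 2
    · simp
    · simp

lemma tripleSum_circleAt (s t : ℝ) : tripleSum (circleAt s, circleAt t) =
    ((Real.cos (2 * Real.pi * s) + Real.cos (2 * Real.pi * t)
      + Real.cos (2 * Real.pi * (s - t)) : ℝ) : ℂ)
    + ((Real.sin (2 * Real.pi * s) - Real.sin (2 * Real.pi * t)
      - Real.sin (2 * Real.pi * (s - t)) : ℝ) : ℂ) * Complex.I := by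
  rw [tripleSum, ← circleAt_neg, ← circleAt_add, ← sub_eq_add_neg, ← circleAt_neg, coe_circleAt,
    coe_circleAt, coe_circleAt, mul_neg, mul_neg, Real.cos_neg, Real.sin_neg, Real.cos_neg,
    Real.sin_neg]
  push_cast
  ring

/-- The characters determine the trace in the 3-dimensional representation of `SU(3)` up to complex
conjugation. -/
lemma tripleSum_eq_or_of_chi_eq {ω ω' : Circle × Circle} (h1 : chi₁ ω = chi₁ ω')
    (h2 : chi₂ ω = chi₂ ω') :
    tripleSum ω = tripleSum ω' ∨ tripleSum ω = tripleSum (ω'.1⁻¹, ω'.2⁻¹) := by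
  obtain ⟨s, t, rfl⟩ := exists_circleAt_pair ω
  obtain ⟨s', t', rfl⟩ := exists_circleAt_pair ω'
  have n := normSq_circle_triple s t
  have n' := normSq_circle_triple s' t'
  have c := chi₁_circleAt s t
  have c' := chi₁_circleAt s' t'
  simp only [← circleAt_neg]
  rw [tripleSum_circleAt, tripleSum_circleAt, tripleSum_circleAt,
    mul_neg, mul_neg, show 2 * Real.pi * (-s' - -t') = -(2 * Real.pi * (s' - t')) by ring,
    Real.cos_neg, Real.cos_neg, Real.cos_neg, Real.sin_neg, Real.sin_neg, Real.sin_neg]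
  set x := Real.cos (2 * Real.pi * s) + Real.cos (2 * Real.pi * t) + Real.cos (2 * Real.pi * (s - t))
  set y := Real.sin (2 * Real.pi * s) - Real.sin (2 * Real.pi * t) - Real.sin (2 * Real.pi * (s - t))
  set x' := Real.cos (2 * Real.pi * s') + Real.cos (2 * Real.pi * t')
    + Real.cos (2 * Real.pi * (s' - t'))
  set y' := Real.sin (2 * Real.pi * s') - Real.sin (2 * Real.pi * t')
    - Real.sin (2 * Real.pi * (s' - t')) with hy'
  have hx : x = x' := by linarith
  have hy : y ^ 2 = y' ^ 2 := by
    have : x ^ 2 = x' ^ 2 := by rw [hx]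
    linarith
  rw [hx]
  rcases sq_eq_sq_iff_eq_or_eq_neg.mp hy with hy | hy
  · left
    rw [hy]
  · right
    rw [hy, hy']
    ring_nf

/-- The remaining ambiguity, complex conjugation of the trace, is the action of -1, which belongs to
the Weyl group of G₂ though not to that of SU(3). -/
lemma weylRel_of_chi_eq {ω ω' : Circle × Circle} (h1 : chi₁ ω = chi₁ ω') (h2 : chi₂ ω = chi₂ ω') :
    WeylRel ω ω' := by
  rcases tripleSum_eq_or_of_chi_eq h1 h2 with h | h
  · exact weylRel_of_tripleSum_eq h
  · simpa using (weylRel_of_tripleSum_eq h).trans (WeylRel.neg _ _)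

/-! ### Alternating sums over the Weyl group -/

/-- Real part of the `3 (k + 4)`-th root of unity with exponent `m`. -/
noncomputable def gridCos (k : ℕ) (m : ℤ) : ℝ := Real.cos (2 * Real.pi * (m / (3 * (k + 4))))

lemma gridCos_neg (k : ℕ) (m : ℤ) : gridCos k (-m) = gridCos k m := by
  rw [gridCos, gridCos, ← Real.cos_neg]
  congr 1; push_cast; ring

lemma gridCos_add_mul (k : ℕ) (m j : ℤ) : gridCos k (m + 3 * (k + 4) * j) = gridCos k m := by
  rw [gridCos, gridCos, ← Real.cos_add_int_mul_two_pi (2 * Real.pi * (m / (3 * (k + 4)))) j]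
  congr 1; push_cast; field_simp

lemma gridCos_eq (k : ℕ) {m m' : ℤ} (h : m = m' ∨ m = -m') : gridCos k m = gridCos k m' := by
  rcases h with rfl | rfl
  · rfl
  · exact gridCos_neg k m'

lemma gridCos_add_add_sub (k : ℕ) (m m' : ℤ) :
    gridCos k (m + m') + gridCos k (m - m') = 2 * gridCos k m * gridCos k m' := by
  simp only [gridCos]
  rw [mul_assoc 2 (Real.cos _), cos_mul_cos_eq]
  have e1 : 2 * Real.pi * (((m + m' : ℤ) : ℝ) / (3 * (k + 4))) =
    2 * Real.pi * (m / (3 * (k + 4))) + 2 * Real.pi * (m' / (3 * (k + 4))) := by push_cast; ring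
  have e2 : 2 * Real.pi * (((m - m' : ℤ) : ℝ) / (3 * (k + 4))) =
    2 * Real.pi * (m / (3 * (k + 4))) - 2 * Real.pi * (m' / (3 * (k + 4))) := by push_cast; ring
  rw [e1, e2]; ring

/-- Six values `3 ⟨w x, y⟩` of the invariant bilinear form, for `w` in the Weyl group modulo `-1`, the
first three for `w` of determinant `1`. -/
def weylPairing (x y : ℤ × ℤ) : Fin 6 → ℤ :=
  ![2 * ((x.1 + x.2) * (y.1 + y.2)) + (x.1 + x.2) * y.2 + x.2 * (y.1 + y.2) + 2 * (x.2 * y.2),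
    -((x.1 + x.2) * (y.1 + y.2)) - 2 * ((x.1 + x.2) * y.2) + x.2 * (y.1 + y.2) - x.2 * y.2,
    -((x.1 + x.2) * (y.1 + y.2)) + (x.1 + x.2) * y.2 - 2 * (x.2 * (y.1 + y.2)) - x.2 * y.2,
    -((x.1 + x.2) * (y.1 + y.2)) - 2 * ((x.1 + x.2) * y.2) - 2 * (x.2 * (y.1 + y.2)) - x.2 * y.2,
    2 * ((x.1 + x.2) * (y.1 + y.2)) + (x.1 + x.2) * y.2 + x.2 * (y.1 + y.2) - x.2 * y.2,
    -((x.1 + x.2) * (y.1 + y.2)) + (x.1 + x.2) * y.2 + x.2 * (y.1 + y.2) + 2 * (x.2 * y.2)]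

lemma weylPairing_add (x y p : ℤ × ℤ) (i : Fin 6) :
    weylPairing x (y + p) i = weylPairing x y i + weylPairing x p i := by
  fin_cases i <;> simp [weylPairing] <;> ring

lemma weylPairing_sub (x y p : ℤ × ℤ) (i : Fin 6) :
    weylPairing x (y - p) i = weylPairing x y i - weylPairing x p i := by
  fin_cases i <;> simp [weylPairing] <;> ring

/-- The determinants of the Weyl group elements in `weylPairing`. -/
def weylSign : Fin 6 → ℝ := ![1, 1, 1, -1, -1, -1]

/-- Half the alternating sum over the Weyl group of the characters at a point of the grid. -/
noncomputable def altSum (k : ℕ) (x y : ℤ × ℤ) : ℝ :=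
  ∑ i, weylSign i * gridCos k (weylPairing x y i)

lemma altSum_eq (k : ℕ) (x y : ℤ × ℤ) : altSum k x y =
    gridCos k (weylPairing x y 0) + gridCos k (weylPairing x y 1) + gridCos k (weylPairing x y 2)
    - gridCos k (weylPairing x y 3) - gridCos k (weylPairing x y 4)
    - gridCos k (weylPairing x y 5) := by
  simp [altSum, Fin.sum_univ_succ, weylSign, Fin.succ]
  ring

/-- Moving w to the other argument of the invariant form replaces it by its inverse. This exchanges
the two rotations of order three and fixes the other four classes. -/
lemma altSum_comm (k : ℕ) (x y : ℤ × ℤ) : altSum k x y = altSum k y x := by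
  have h : ∀ i j, weylPairing x y i = weylPairing y x j →
    gridCos k (weylPairing x y i) = gridCos k (weylPairing y x j) := fun i j h => by rw [h]
  rw [altSum_eq, altSum_eq, h 0 0, h 1 2, h 2 1, h 3 3, h 4 4, h 5 5]
  · ring
  all_goals simp [weylPairing]; ring

/-- A function on the weights that changes sign under the reflections generating the affine Weyl group
of level `n - 4`. -/
structure IsAffineAlternating (n : ℤ) (F : ℤ → ℤ → ℝ) : Prop where
  short : ∀ u v, F (-u) (u + v) = -F u v
  long : ∀ u v, F (u + 3 * v) (-v) = -F u v
  affine : ∀ u v, F u (n - u - v) = -F u v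

lemma IsAffineAlternating.short_wall {n : ℤ} {F : ℤ → ℤ → ℝ} (h : IsAffineAlternating n F) (v : ℤ) :
    F 0 v = 0 := by
  have := h.short 0 v
  simp only [neg_zero, zero_add] at this
  linarith

lemma IsAffineAlternating.long_wall {n : ℤ} {F : ℤ → ℤ → ℝ} (h : IsAffineAlternating n F) (u : ℤ) :
    F u 0 = 0 := by
  have := h.long u 0
  simp only [neg_zero, mul_zero, add_zero] at this
  linarith

lemma IsAffineAlternating.affine_wall {n : ℤ} {F : ℤ → ℤ → ℝ} (h : IsAffineAlternating n F)
    {u v : ℤ} (huv : u + 2 * v = n) : F u v = 0 := by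
  have := h.affine u v
  rw [show n - u - v = v by omega] at this
  linarith

/-- Each reflection exchanges the three terms of determinant 1 with the three of determinant -1, up
to the sign of the exponent. The affine reflection has a translation part as well, which alters
exponents by multiples of 3(k+4); the shift k + 4 is the level plus the dual Coxeter number of G₂.
-/
lemma isAffineAlternating_altSum (k : ℕ) (x : ℤ × ℤ) :
    IsAffineAlternating (k + 4) fun u v => altSum k x (u, v) := by
  refine ⟨fun u v => ?_, fun u v => ?_, fun u v => ?_⟩
  · have h : ∀ i j, weylPairing x (-u, u + v) i = -weylPairing x (u, v) j →
      gridCos k (weylPairing x (-u, u + v) i) = gridCos k (weylPairing x (u, v) j) :=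
        fun i j h => gridCos_eq k (Or.inr h)
    rw [altSum_eq, altSum_eq, h 0 3, h 1 4, h 2 5, h 3 0, h 4 1, h 5 2]
    · ring
    all_goals simp [weylPairing]; ring
  · have h : ∀ i j, weylPairing x (u + 3 * v, -v) i = weylPairing x (u, v) j →
      gridCos k (weylPairing x (u + 3 * v, -v) i) = gridCos k (weylPairing x (u, v) j) :=
        fun i j h => gridCos_eq k (Or.inl h)
    rw [altSum_eq, altSum_eq, h 0 4, h 1 5, h 2 3, h 3 2, h 4 0, h 5 1]
    · ring
    all_goals simp [weylPairing]; ring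
  · have h : ∀ i j t, weylPairing x (u, k + 4 - u - v) i = weylPairing x (u, v) j + 3 * (k + 4) * t →
      gridCos k (weylPairing x (u, k + 4 - u - v) i) = gridCos k (weylPairing x (u, v) j) :=
        fun i j t h => by rw [h, gridCos_add_mul]
    rw [altSum_eq, altSum_eq, h 0 3 (x.1 + 2 * x.2), h 1 4 (-(x.1 + x.2)), h 2 5 (-x.2),
      h 3 0 (-(x.1 + 2 * x.2)), h 4 1 (x.1 + x.2), h 5 2 x.2]
    · ring
    all_goals simp [weylPairing]; ring

/-- The point of the torus of the weight `x`, in the coordinates of the Dynkin labels. -/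
noncomputable def weightPoint (k : ℕ) (x : ℤ × ℤ) : Circle × Circle :=
  (circleAt ((x.1 + 3 * x.2) / (3 * (k + 4))), circleAt (-x.1 / (3 * (k + 4))))

lemma reChar_weightPoint (k : ℕ) (x : ℤ × ℤ) (a b : ℤ) :
    reChar a b (weightPoint k x) = gridCos k (a * (x.1 + 3 * x.2) - b * x.1) := by
  rw [weightPoint, reChar_circleAt, gridCos]
  congr 1; push_cast; ring

/-- J is the Weyl denominator, that is, the alternating sum at y = (1, 1), the half sum of positive
roots. The exponents match term by term up to sign. -/
lemma jacobian_weightPoint (k : ℕ) (x : ℤ × ℤ) :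
    jacobian (weightPoint k x) = 8 * Real.pi ^ 2 * altSum k x (1, 1) := by
  simp only [jacobian, reChar_weightPoint]
  rw [altSum_eq, gridCos_eq k (m := 2 * (x.1 + 3 * x.2) - 1 * x.1) (m' := weylPairing x (1, 1) 2)
      (by simp [weylPairing]; omega),
    gridCos_eq k (m := 1 * (x.1 + 3 * x.2) - (-3) * x.1) (m' := weylPairing x (1, 1) 1)
      (by simp [weylPairing]; omega),
    gridCos_eq k (m := 3 * (x.1 + 3 * x.2) - (-2) * x.1) (m' := weylPairing x (1, 1) 0)
      (by simp [weylPairing]; omega),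
    gridCos_eq k (m := 1 * (x.1 + 3 * x.2) - 2 * x.1) (m' := weylPairing x (1, 1) 5)
      (by simp [weylPairing]; omega),
    gridCos_eq k (m := 3 * (x.1 + 3 * x.2) - (-1) * x.1) (m' := weylPairing x (1, 1) 3)
      (by simp [weylPairing]; omega),
    gridCos_eq k (m := 2 * (x.1 + 3 * x.2) - (-3) * x.1) (m' := weylPairing x (1, 1) 4)
      (by simp [weylPairing]; omega)]
  ring

lemma altSum_add_add_sub (k : ℕ) (x y p : ℤ × ℤ) : altSum k x (y + p) + altSum k x (y - p) =
    ∑ i, weylSign i * (2 * gridCos k (weylPairing x y i) * gridCos k (weylPairing x p i)) := by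
  simp only [altSum, weylPairing_add, weylPairing_sub, ← gridCos_add_add_sub]
  rw [← Finset.sum_add_distrib]
  exact Finset.sum_congr rfl fun i _ => by ring

/-- The vectors (1,0), (-1,1), (2,-1) represent the short roots modulo sign. Each Weyl group element
permutes them modulo sign, so the sum is independent of i; the six cases are the six permutations.
-/
lemma sum_short_gridCos (k : ℕ) (x : ℤ × ℤ) (i : Fin 6) :
    gridCos k (weylPairing x (1, 0) i) + gridCos k (weylPairing x (-1, 1) i)
      + gridCos k (weylPairing x (2, -1) i)
    = gridCos k x.1 + gridCos k (x.1 + 3 * x.2) + gridCos k (2 * x.1 + 3 * x.2) := by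
  fin_cases i
  · exact (congrArg₂ (· + ·) (congrArg₂ (· + ·)
      (gridCos_eq k (m := weylPairing x (1, 0) _) (m' := (2 * x.1 + 3 * x.2)) (by simp [weylPairing]; omega))
      (gridCos_eq k (m := weylPairing x (-1, 1) _) (m' := (x.1 + 3 * x.2)) (by simp [weylPairing]; omega)))
      (gridCos_eq k (m := weylPairing x (2, -1) _) (m' := x.1) (by simp [weylPairing]; omega))).trans
      (by ring)
  · exact (congrArg₂ (· + ·) (congrArg₂ (· + ·)
      (gridCos_eq k (m := weylPairing x (1, 0) _) (m' := x.1) (by simp [weylPairing]))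
      (gridCos_eq k (m := weylPairing x (-1, 1) _) (m' := (2 * x.1 + 3 * x.2)) (by simp [weylPairing]; omega)))
      (gridCos_eq k (m := weylPairing x (2, -1) _) (m' := (x.1 + 3 * x.2)) (by simp [weylPairing]; omega))).trans
      (by ring)
  · exact (congrArg₂ (· + ·) (congrArg₂ (· + ·)
      (gridCos_eq k (m := weylPairing x (1, 0) _) (m' := (x.1 + 3 * x.2)) (by simp [weylPairing]; omega))
      (gridCos_eq k (m := weylPairing x (-1, 1) _) (m' := x.1) (by simp [weylPairing])))
      (gridCos_eq k (m := weylPairing x (2, -1) _) (m' := (2 * x.1 + 3 * x.2)) (by simp [weylPairing]; omega))).trans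
      (by ring)
  · exact (congrArg₂ (· + ·) (congrArg₂ (· + ·)
      (gridCos_eq k (m := weylPairing x (1, 0) _) (m' := (x.1 + 3 * x.2)) (by simp [weylPairing]; omega))
      (gridCos_eq k (m := weylPairing x (-1, 1) _) (m' := (2 * x.1 + 3 * x.2)) (by simp [weylPairing]; omega)))
      (gridCos_eq k (m := weylPairing x (2, -1) _) (m' := x.1) (by simp [weylPairing]; omega))).trans
      (by ring)
  · exact (congrArg₂ (· + ·) (congrArg₂ (· + ·)
      (gridCos_eq k (m := weylPairing x (1, 0) _) (m' := (2 * x.1 + 3 * x.2)) (by simp [weylPairing]; omega))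
      (gridCos_eq k (m := weylPairing x (-1, 1) _) (m' := x.1) (by simp [weylPairing])))
      (gridCos_eq k (m := weylPairing x (2, -1) _) (m' := (x.1 + 3 * x.2)) (by simp [weylPairing]; omega))).trans
      (by ring)
  · exact (congrArg₂ (· + ·) (congrArg₂ (· + ·)
      (gridCos_eq k (m := weylPairing x (1, 0) _) (m' := x.1) (by simp [weylPairing]))
      (gridCos_eq k (m := weylPairing x (-1, 1) _) (m' := (x.1 + 3 * x.2)) (by simp [weylPairing]; omega)))
      (gridCos_eq k (m := weylPairing x (2, -1) _) (m' := (2 * x.1 + 3 * x.2)) (by simp [weylPairing]; omega))).trans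
      (by ring)

lemma sum_long_gridCos (k : ℕ) (x : ℤ × ℤ) (i : Fin 6) :
    gridCos k (weylPairing x (0, 1) i) + gridCos k (weylPairing x (3, -1) i)
      + gridCos k (weylPairing x (3, -2) i)
    = gridCos k (3 * x.1 + 3 * x.2) + gridCos k (3 * x.2) + gridCos k (3 * x.1 + 6 * x.2) := by
  fin_cases i
  · exact (congrArg₂ (· + ·) (congrArg₂ (· + ·)
      (gridCos_eq k (m := weylPairing x (0, 1) _) (m' := (3 * x.1 + 6 * x.2)) (by simp [weylPairing]; omega))
      (gridCos_eq k (m := weylPairing x (3, -1) _) (m' := (3 * x.1 + 3 * x.2)) (by simp [weylPairing]; omega)))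
      (gridCos_eq k (m := weylPairing x (3, -2) _) (m' := (3 * x.2)) (by simp [weylPairing]; omega))).trans
      (by ring)
  · exact (congrArg₂ (· + ·) (congrArg₂ (· + ·)
      (gridCos_eq k (m := weylPairing x (0, 1) _) (m' := (3 * x.1 + 3 * x.2)) (by simp [weylPairing]; omega))
      (gridCos_eq k (m := weylPairing x (3, -1) _) (m' := (3 * x.2)) (by simp [weylPairing]; omega)))
      (gridCos_eq k (m := weylPairing x (3, -2) _) (m' := (3 * x.1 + 6 * x.2)) (by simp [weylPairing]; omega))).trans
      (by ring)
  · exact (congrArg₂ (· + ·) (congrArg₂ (· + ·)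
      (gridCos_eq k (m := weylPairing x (0, 1) _) (m' := (3 * x.2)) (by simp [weylPairing]; omega))
      (gridCos_eq k (m := weylPairing x (3, -1) _) (m' := (3 * x.1 + 6 * x.2)) (by simp [weylPairing]; omega)))
      (gridCos_eq k (m := weylPairing x (3, -2) _) (m' := (3 * x.1 + 3 * x.2)) (by simp [weylPairing]; omega))).trans
      (by ring)
  · exact (congrArg₂ (· + ·) (congrArg₂ (· + ·)
      (gridCos_eq k (m := weylPairing x (0, 1) _) (m' := (3 * x.1 + 6 * x.2)) (by simp [weylPairing]; omega))
      (gridCos_eq k (m := weylPairing x (3, -1) _) (m' := (3 * x.2)) (by simp [weylPairing]; omega)))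
      (gridCos_eq k (m := weylPairing x (3, -2) _) (m' := (3 * x.1 + 3 * x.2)) (by simp [weylPairing]; omega))).trans
      (by ring)
  · exact (congrArg₂ (· + ·) (congrArg₂ (· + ·)
      (gridCos_eq k (m := weylPairing x (0, 1) _) (m' := (3 * x.1 + 3 * x.2)) (by simp [weylPairing]; omega))
      (gridCos_eq k (m := weylPairing x (3, -1) _) (m' := (3 * x.1 + 6 * x.2)) (by simp [weylPairing]; omega)))
      (gridCos_eq k (m := weylPairing x (3, -2) _) (m' := (3 * x.2)) (by simp [weylPairing]; omega))).trans
      (by ring)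
  · exact (congrArg₂ (· + ·) (congrArg₂ (· + ·)
      (gridCos_eq k (m := weylPairing x (0, 1) _) (m' := (3 * x.2)) (by simp [weylPairing]; omega))
      (gridCos_eq k (m := weylPairing x (3, -1) _) (m' := (3 * x.1 + 3 * x.2)) (by simp [weylPairing]; omega)))
      (gridCos_eq k (m := weylPairing x (3, -2) _) (m' := (3 * x.1 + 6 * x.2)) (by simp [weylPairing]; omega))).trans
      (by ring)

/-- The weights of the 7-dimensional representation are 0 and the six short roots. By Weyl
invariance the character can be taken inside the alternating sum, where each product of cosines
splits into the translates by plus and minus a root. -/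
lemma chi₁_mul_altSum (k : ℕ) (x y : ℤ × ℤ) : chi₁ (weightPoint k x) * altSum k x y =
    altSum k x y + (altSum k x (y + (1, 0)) + altSum k x (y - (1, 0)))
      + (altSum k x (y + (-1, 1)) + altSum k x (y - (-1, 1)))
      + (altSum k x (y + (2, -1)) + altSum k x (y - (2, -1))) := by
  have hc : chi₁ (weightPoint k x) =
      1 + 2 * (gridCos k x.1 + gridCos k (x.1 + 3 * x.2) + gridCos k (2 * x.1 + 3 * x.2)) := by
    simp only [chi₁, reChar_weightPoint]
    rw [gridCos_eq k (m := 0 * (x.1 + 3 * x.2) - 1 * x.1) (m' := x.1) (by right; ring)]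
    ring_nf
  have h : 2 * (gridCos k x.1 + gridCos k (x.1 + 3 * x.2) + gridCos k (2 * x.1 + 3 * x.2))
      * altSum k x y = ∑ i, (weylSign i * (2 * gridCos k (weylPairing x y i) * gridCos k (weylPairing x (1, 0) i))
        + (weylSign i * (2 * gridCos k (weylPairing x y i) * gridCos k (weylPairing x (-1, 1) i))
        + weylSign i * (2 * gridCos k (weylPairing x y i) * gridCos k (weylPairing x (2, -1) i)))) := by
    rw [altSum, Finset.mul_sum]
    refine Finset.sum_congr rfl fun i _ => ?_
    rw [← sum_short_gridCos k x i]
    ring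
  rw [Finset.sum_add_distrib, Finset.sum_add_distrib] at h
  rw [altSum_add_add_sub, altSum_add_add_sub, altSum_add_add_sub, hc]
  linear_combination h

lemma chi₂_mul_altSum (k : ℕ) (x y : ℤ × ℤ) : chi₂ (weightPoint k x) * altSum k x y =
    chi₁ (weightPoint k x) * altSum k x y
      + altSum k x y + (altSum k x (y + (0, 1)) + altSum k x (y - (0, 1)))
      + (altSum k x (y + (3, -1)) + altSum k x (y - (3, -1)))
      + (altSum k x (y + (3, -2)) + altSum k x (y - (3, -2))) := by
  have hc : chi₂ (weightPoint k x) = chi₁ (weightPoint k x) +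
      1 + 2 * (gridCos k (3 * x.1 + 3 * x.2) + gridCos k (3 * x.2) + gridCos k (3 * x.1 + 6 * x.2)) := by
    simp only [chi₂, reChar_weightPoint]
    ring_nf
  have h : 2 * (gridCos k (3 * x.1 + 3 * x.2) + gridCos k (3 * x.2) + gridCos k (3 * x.1 + 6 * x.2))
      * altSum k x y = ∑ i, (weylSign i * (2 * gridCos k (weylPairing x y i) * gridCos k (weylPairing x (0, 1) i))
        + (weylSign i * (2 * gridCos k (weylPairing x y i) * gridCos k (weylPairing x (3, -1) i))
        + weylSign i * (2 * gridCos k (weylPairing x y i) * gridCos k (weylPairing x (3, -2) i)))) := by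
    rw [altSum, Finset.mul_sum]
    refine Finset.sum_congr rfl fun i _ => ?_
    rw [← sum_long_gridCos k x i]
    ring
  rw [Finset.sum_add_distrib, Finset.sum_add_distrib] at h
  rw [altSum_add_add_sub, altSum_add_add_sub, altSum_add_add_sub, hc]
  linear_combination h

/-! ### The rows of the fusion graphs -/

/-- The value at the end of the edge of `shiftEntry m p n q` that starts at `(u - 1, v - 1)`, and zero
if there is no such edge at the level of `N`. -/
noncomputable def edgeValue (N : ℤ) (F : ℤ → ℤ → ℝ) (m p n q u v : ℤ) : ℝ :=
  if p < u ∧ q < v ∧ (u - p + m) + 2 * (v - q + n) < N then F (u - p + m) (v - q + n) else 0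

lemma sum_shiftEntry (k : ℕ) (F : ℤ → ℤ → ℝ) (m p n q : ℕ) (x : ℕ × ℕ) :
    ∑ y : alcove k, (shiftEntry m p n q x y : ℝ) * F (y.1.1 + 1) (y.1.2 + 1) =
      edgeValue (k + 4) F m p n q (x.1 + 1) (x.2 + 1) := by
  rw [Finset.sum_coe_sort (alcove k)
    (fun y => (shiftEntry m p n q x y : ℝ) * F (y.1 + 1) (y.2 + 1)), edgeValue]
  by_cases h : p ≤ x.1 ∧ q ≤ x.2
  · simp only [shiftEntry, h.1, h.2, true_and, Nat.cast_ite, Nat.cast_one, Nat.cast_zero, ite_mul,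
      one_mul, zero_mul, Finset.sum_ite_eq']
    -- In the shifted labels u = x₁ + 1, v = x₂ + 1, the conditions x₁, x₂ ≥ 0 and x₁ + 2x₂ ≤ k read
    -- u, v > 0 and u + 2v < k + 4, so all inequalities become strict.
    have hm : (x.1 - p + m, x.2 - q + n) ∈ alcove k ↔ ((p : ℤ) < x.1 + 1 ∧ (q : ℤ) < x.2 + 1 ∧
        ((x.1 : ℤ) + 1 - p + m) + 2 * (x.2 + 1 - q + n) < k + 4) := by
      simp only [alcove, Finset.mem_filter, Finset.mem_product, Finset.mem_range]
      omega
    rw [if_congr hm _ rfl]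
    push_cast [Nat.cast_sub h.1, Nat.cast_sub h.2]
    congr 1 <;> ring
  · rw [if_neg (by omega)]
    refine Finset.sum_eq_zero fun y _ => ?_
    rw [shiftEntry, if_neg (by tauto)]
    simp

/-- If an edge can fail to exist only because its end would lie on a wall, the test for existence is
redundant, since F vanishes there. -/
lemma edgeValue_of_wall {N : ℤ} {F : ℤ → ℤ → ℝ} (h : IsAffineAlternating N F) {u v m p n q : ℤ}
    (hpq : ¬ (p < u ∧ q < v ∧ (u - p + m) + 2 * (v - q + n) < N) →
      u - p + m = 0 ∨ v - q + n = 0 ∨ (u - p + m) + 2 * (v - q + n) = N) :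
    edgeValue N F m p n q u v = F (u - p + m) (v - q + n) := by
  rw [edgeValue]
  split_ifs with hc
  · rfl
  · rcases hpq hc with h0 | h0 | h0
    · rw [h0, h.short_wall]
    · rw [h0, h.long_wall]
    · rw [h.affine_wall h0]

/-- From u = 1 the step (-2, 1) jumps over the wall u = 0 to (-1, v + 1), the mirror image of the
starting point, where F takes the value -F u v. The correction cancels against the short loop, which
is missing exactly for u = 1. -/
lemma edgeValue_neg_two {N : ℤ} {F : ℤ → ℤ → ℝ} (h : IsAffineAlternating N F) {u v : ℤ}
    (hu : 1 ≤ u) (hv : 1 ≤ v) (hN : u + 2 * v < N) :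
    edgeValue N F 0 2 1 0 u v = F (u - 2) (v + 1) + if u = 1 then F u v else 0 := by
  split_ifs with h1
  · subst h1
    have := h.short 1 v
    rw [edgeValue, if_neg (by omega), show (1 : ℤ) - 2 = -1 by ring, add_comm v 1, this]
    ring
  · rw [edgeValue_of_wall h (by omega), add_zero, add_zero, sub_zero]

lemma edgeValue_loop_short {N : ℤ} {F : ℤ → ℤ → ℝ} {u v : ℤ}
    (hu : 1 ≤ u) (hv : 1 ≤ v) (hN : u + 2 * v < N) :
    edgeValue N F 1 1 0 0 u v = F u v - if u = 1 then F u v else 0 := by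
  rw [edgeValue]
  split_ifs with h1 h2 h2
  · omega
  · ring_nf
  · ring
  · omega

/-- The edges of the McKay graph of the 7-dimensional representation lead from a weight to its
translates by the seven weights, up to the affine Weyl group. -/
lemma sum_edgeValue_seven {N : ℤ} {F : ℤ → ℤ → ℝ} (h : IsAffineAlternating N F) {u v : ℤ}
    (hu : 1 ≤ u) (hv : 1 ≤ v) (hN : u + 2 * v < N) :
    edgeValue N F 1 1 0 0 u v + edgeValue N F 1 0 0 0 u v + edgeValue N F 0 1 0 0 u v
      + edgeValue N F 0 1 1 0 u v + edgeValue N F 1 0 0 1 u v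
      + edgeValue N F 2 0 0 1 u v + edgeValue N F 0 2 1 0 u v =
    F u v + (F (u + 1) v + F (u - 1) v) + (F (u - 1) (v + 1) + F (u + 1) (v - 1))
      + (F (u + 2) (v - 1) + F (u - 2) (v + 1)) := by
  rw [edgeValue_neg_two h hu hv hN, edgeValue_loop_short hu hv hN]
  rw [edgeValue_of_wall (m := 1) (p := 0) (n := 0) (q := 0) h (by omega),
    edgeValue_of_wall (m := 0) (p := 1) (n := 0) (q := 0) h (by omega),
    edgeValue_of_wall (m := 0) (p := 1) (n := 1) (q := 0) h (by omega),
    edgeValue_of_wall (m := 1) (p := 0) (n := 0) (q := 1) h (by omega),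
    edgeValue_of_wall (m := 2) (p := 0) (n := 0) (q := 1) h (by omega)]
  simp only [sub_zero, add_zero]
  ring

/-- The edges of the McKay graph of the 14-dimensional representation lead from a weight to its
translates by the fourteen weights, up to the affine Weyl group. -/
lemma sum_edgeValue_fourteen {N : ℤ} {F : ℤ → ℤ → ℝ} (h : IsAffineAlternating N F) {u v : ℤ}
    (hu : 1 ≤ u) (hv : 1 ≤ v) (hN : u + 2 * v < N) :
    edgeValue N F 1 1 0 0 u v + edgeValue N F 2 1 0 0 u v + edgeValue N F 1 2 0 0 u v
      + edgeValue N F 1 2 1 0 u v + edgeValue N F 2 1 0 1 u v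
      + edgeValue N F 2 0 0 1 u v + edgeValue N F 0 2 1 0 u v
      + edgeValue N F 0 0 1 1 u v + edgeValue N F 0 0 1 0 u v + edgeValue N F 0 0 0 1 u v
      + edgeValue N F 3 0 0 1 u v + edgeValue N F 0 3 1 0 u v
      + edgeValue N F 3 0 0 2 u v + edgeValue N F 0 3 2 0 u v
      - (if u + 2 * v = N - 1 then F u v else 0) =
    F u v + (F (u + 1) v + F (u - 1) v) + (F (u - 1) (v + 1) + F (u + 1) (v - 1))
      + (F (u + 2) (v - 1) + F (u - 2) (v + 1)) + F u v + (F u (v + 1) + F u (v - 1))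
      + (F (u + 3) (v - 1) + F (u - 3) (v + 1)) + (F (u + 3) (v - 2) + F (u - 3) (v + 2)) := by
  -- The corrections cancel in pairs. Steps by -3 in the first label started at u = 1 or u = 2 are
  -- reflected in the wall u = 0, and their images are the ends of the edges that the powers of l*
  -- remove at those u.
  have t1 : edgeValue N F 2 1 0 0 u v = F (u + 1) v - if u = 1 then F (u + 1) v else 0 := by
    split_ifs with h1
    · rw [edgeValue, if_neg (by omega), sub_self]
    · rw [edgeValue_of_wall h (by omega), sub_zero, sub_zero, add_zero]
      ring_nf
  have t2 : edgeValue N F 1 2 0 0 u v = F (u - 1) v - if u = 2 then F (u - 1) v else 0 := by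
    split_ifs with h1
    · rw [edgeValue, if_neg (by omega), sub_self]
    · rw [edgeValue_of_wall h (by omega), sub_zero, sub_zero, add_zero]
      ring_nf
  have t3 : edgeValue N F 1 2 1 0 u v =
      F (u - 1) (v + 1) - if u = 2 then F (u - 1) (v + 1) else 0 := by
    split_ifs with h1
    · rw [edgeValue, if_neg (by omega), sub_self]
    · rw [edgeValue_of_wall h (by omega), sub_zero, sub_zero]
      ring_nf
  have t4 : edgeValue N F 2 1 0 1 u v =
      F (u + 1) (v - 1) - if u = 1 then F (u + 1) (v - 1) else 0 := by
    split_ifs with h1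
    · rw [edgeValue, if_neg (by omega), sub_self]
    · rw [edgeValue_of_wall h (by omega), sub_zero, add_zero]
      ring_nf
  have t5 : edgeValue N F 0 0 1 1 u v = F u v - if v = 1 then F u v else 0 := by
    split_ifs with h1
    · rw [edgeValue, if_neg (by omega), sub_self]
    · rw [edgeValue_of_wall h (by omega), sub_zero]
      ring_nf
  -- Only the step (0, 1) raises u + 2v by two and so crosses the affine wall. From the cut-off line
  -- u + 2v = N - 1 its end is the mirror image of the starting point, and this is what the removed
  -- self-loop compensates.
  have t6 : edgeValue N F 0 0 1 0 u v = F u (v + 1) + if u + 2 * v = N - 1 then F u v else 0 := by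
    split_ifs with h1
    · have := h.affine u v
      rw [show N - u - v = v + 1 by omega] at this
      rw [edgeValue, if_neg (by omega), this]
      ring
    · rw [edgeValue_of_wall h (by omega)]
      ring_nf
  have t7 : edgeValue N F 0 3 1 0 u v = F (u - 3) (v + 1)
      + (if u = 1 then F (u + 1) (v - 1) else 0) + if u = 2 then F (u - 1) v else 0 := by
    by_cases h1 : u = 1
    · subst h1
      have := h.short 2 (v - 1)
      rw [show 2 + (v - 1) = v + 1 by ring] at this
      rw [edgeValue, if_neg (by omega)]
      norm_num
      linarith
    by_cases h2 : u = 2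
    · subst h2
      have := h.short 1 v
      rw [add_comm] at this
      rw [edgeValue, if_neg (by omega)]
      norm_num
      linarith
    rw [edgeValue_of_wall h (by omega), if_neg h1, if_neg h2]
    ring_nf
  have t8 : edgeValue N F 0 3 2 0 u v = F (u - 3) (v + 2)
      + (if u = 1 then F (u + 1) v else 0) + if u = 2 then F (u - 1) (v + 1) else 0 := by
    by_cases h1 : u = 1
    · subst h1
      have := h.short 2 v
      rw [add_comm] at this
      rw [edgeValue, if_neg (by omega)]
      norm_num
      linarith
    by_cases h2 : u = 2
    · subst h2
      have := h.short 1 (v + 1)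
      rw [show 1 + (v + 1) = v + 2 by ring] at this
      rw [edgeValue, if_neg (by omega)]
      norm_num
      linarith
    rw [edgeValue_of_wall h (by omega), if_neg h1, if_neg h2]
    ring_nf
  -- From v = 1 the step (3, -2) crosses the long wall to the mirror image of the starting point;
  -- this matches the long loop, which is missing at v = 1.
  have t9 : edgeValue N F 3 0 0 2 u v = F (u + 3) (v - 2) + if v = 1 then F u v else 0 := by
    split_ifs with h1
    · subst h1
      have := h.long u 1
      rw [edgeValue, if_neg (by omega)]
      norm_num at this ⊢
      linarith
    · rw [edgeValue_of_wall h (by omega)]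
      ring_nf
  rw [t1, t2, t3, t4, t5, t6, t7, t8, t9, edgeValue_neg_two h hu hv hN,
    edgeValue_loop_short hu hv hN]
  rw [edgeValue_of_wall (m := 2) (p := 0) (n := 0) (q := 1) h (by omega),
    edgeValue_of_wall (m := 0) (p := 0) (n := 0) (q := 1) h (by omega),
    edgeValue_of_wall (m := 3) (p := 0) (n := 0) (q := 1) h (by omega)]
  simp only [sub_zero, add_zero]
  ring

lemma mem_alcove {k : ℕ} {x : ℕ × ℕ} : x ∈ alcove k ↔ x.1 + 2 * x.2 ≤ k := by
  simp only [alcove, Finset.mem_filter, Finset.mem_product, Finset.mem_range]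
  omega

/-- The shifted weight `x + ρ` of a vertex. -/
def shifted (x : ℕ × ℕ) : ℤ × ℤ := (x.1 + 1, x.2 + 1)

lemma sum_fusionGraph₁_mul_altSum (k : ℕ) (s : ℤ × ℤ) (x : alcove k) :
    ∑ y : alcove k, (fusionGraph₁ k x y : ℝ) * altSum k s (shifted y) =
      chi₁ (weightPoint k s) * altSum k s (shifted x) := by
  have hx := mem_alcove.mp x.2
  have h := sum_edgeValue_seven (isAffineAlternating_altSum k s) (u := x.1.1 + 1) (v := x.1.2 + 1)
    (by omega) (by omega) (by omega)
  rw [chi₁_mul_altSum]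
  simp only [fusionGraph₁, Matrix.of_apply, mcKay₁, Nat.cast_add, add_mul, Finset.sum_add_distrib,
    shifted]
  have e := sum_shiftEntry k (fun u v => altSum k s (u, v))
  simp only [e]
  push_cast
  rw [h]
  simp only [Prod.mk_add_mk, Prod.mk_sub_mk, sub_neg_eq_add, add_zero, sub_zero, ← sub_eq_add_neg]

lemma sum_fusionGraph₂_mul_altSum {k : ℕ} (hk : 1 ≤ k) (s : ℤ × ℤ) (x : alcove k) :
    ∑ y : alcove k, (fusionGraph₂ k x y : ℝ) * altSum k s (shifted y) =
      chi₂ (weightPoint k s) * altSum k s (shifted x) := by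
  have hx := mem_alcove.mp x.2
  have h := sum_edgeValue_fourteen (isAffineAlternating_altSum k s) (u := x.1.1 + 1)
    (v := x.1.2 + 1) (by omega) (by omega) (by omega)
  rw [chi₂_mul_altSum, chi₁_mul_altSum]
  have hsub : ∀ y : alcove k, (fusionGraph₂ k x y : ℝ) * altSum k s (shifted y) =
      mcKay₂ x y * altSum k s (shifted y) -
        if x = y then (if x.1.1 + 2 * x.1.2 = k then altSum k s (shifted y) else 0) else 0 := by
    intro y
    rw [fusionGraph₂, Matrix.of_apply, Nat.cast_sub]
    · split_ifs <;> simp_all [sub_mul]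
    · split_ifs with hc
      · obtain ⟨rfl, hc⟩ := hc
        -- The subtraction of natural numbers is not truncated: since x₁ + 2x₂ = k ≥ 1, one of the
        -- labels is positive and carries a self-loop.
        have : 1 ≤ shiftEntry 1 1 0 0 x.1 x.1 + shiftEntry 0 0 1 1 x.1 x.1 := by
          by_cases h1 : 1 ≤ x.1.1
          · have : shiftEntry 1 1 0 0 x.1 x.1 = 1 := by
              rw [shiftEntry, if_pos]
              exact ⟨h1, Nat.zero_le _, Prod.ext (by simp; omega) (by simp)⟩
            omega
          · have : shiftEntry 0 0 1 1 x.1 x.1 = 1 := by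
              rw [shiftEntry, if_pos]
              exact ⟨Nat.zero_le _, by omega, Prod.ext (by simp) (by simp; omega)⟩
            omega
        rw [mcKay₂]
        omega
      · exact Nat.zero_le _
  simp only [hsub, Finset.sum_sub_distrib, Finset.sum_ite_eq, Finset.mem_univ, if_true]
  simp only [mcKay₂, Nat.cast_add, add_mul, Finset.sum_add_distrib, shifted]
  have e := sum_shiftEntry k (fun u v => altSum k s (u, v))
  have hif : ((x.1.1 : ℤ) + 1 + 2 * (x.1.2 + 1) = (k : ℤ) + 4 - 1) ↔ x.1.1 + 2 * x.1.2 = k := by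
    omega
  simp only [hif] at h
  simp only [e]
  push_cast
  rw [h]
  simp only [Prod.mk_add_mk, Prod.mk_sub_mk, sub_neg_eq_add, add_zero, sub_zero, ← sub_eq_add_neg]

/-! ### Symmetry of the graphs and the fundamental characters -/

lemma shiftEntry_comm (m p n q : ℕ) (x y : ℕ × ℕ) :
    shiftEntry m p n q x y = shiftEntry p m q n y x := by
  simp only [shiftEntry, Prod.ext_iff]
  congr 1
  simp only [eq_iff_iff]
  omega

lemma fusionGraph₁_comm (k : ℕ) (x y : alcove k) : fusionGraph₁ k x y = fusionGraph₁ k y x := by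
  simp only [fusionGraph₁, Matrix.of_apply, mcKay₁]
  rw [shiftEntry_comm 1 1 0 0, shiftEntry_comm 1 0 0 0, shiftEntry_comm 0 1 0 0 x.1,
    shiftEntry_comm 0 1 1 0 x.1, shiftEntry_comm 1 0 0 1 x.1, shiftEntry_comm 2 0 0 1 x.1,
    shiftEntry_comm 0 2 1 0 x.1]
  ring

lemma fusionGraph₂_comm (k : ℕ) (x y : alcove k) : fusionGraph₂ k x y = fusionGraph₂ k y x := by
  have h : mcKay₂ x y = mcKay₂ y x := by
    simp only [mcKay₂]
    simp only [fun m p n q => shiftEntry_comm m p n q x.1 y.1]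
    ring
  simp only [fusionGraph₂, Matrix.of_apply, h]
  by_cases hxy : x = y
  · subst hxy; rfl
  · simp [hxy, Ne.symm hxy, eq_comm]

/-- The Weyl character formula for the 7-dimensional representation. Among the translates of (1, 1)
four lie on walls, and (-1, 2) is the mirror image of (1, 1), so it cancels the weight 0. -/
lemma altSum_short_weight (k : ℕ) (s : ℤ × ℤ) :
    altSum k s (2, 1) = chi₁ (weightPoint k s) * altSum k s (1, 1) := by
  have h := isAffineAlternating_altSum k s
  rw [chi₁_mul_altSum]
  have s1 := h.short 1 1
  have z := h.short_wall
  have w := h.long_wall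
  norm_num [z, w] at s1 ⊢
  rw [s1]
  ring

/-- The Weyl character formula for the adjoint representation. The points (4, -1) and (-2, 3) are
mirror images of (1, 1) and (2, 1) and cancel them; all translates other than (1, 2) that are left
vanish. -/
lemma altSum_long_weight (k : ℕ) (s : ℤ × ℤ) :
    altSum k s (1, 2) = chi₂ (weightPoint k s) * altSum k s (1, 1) := by
  have h := isAffineAlternating_altSum k s
  rw [chi₂_mul_altSum, ← altSum_short_weight]
  have s1 := h.short 2 1
  have s3 := h.short 2 0
  have s2 := h.long 1 1
  have z := h.short_wall
  have w := h.long_wall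
  norm_num [z, w] at s1 s2 s3 ⊢
  rw [s1, s2, s3]
  ring

/-! ### The grid of torus points -/

/-- The point of the torus with coordinates the `3 (k + 4)`-th roots of unity with exponents `q`. -/
noncomputable def gridPoint (k : ℕ) (q : ℤ × ℤ) : Circle × Circle :=
  (circleAt (q.1 / (3 * (k + 4))), circleAt (q.2 / (3 * (k + 4))))

lemma weightPoint_eq_gridPoint (k : ℕ) (x : ℤ × ℤ) :
    weightPoint k x = gridPoint k (x.1 + 3 * x.2, -x.1) := by
  simp [weightPoint, gridPoint]

lemma circleAt_div_eq_iff (k : ℕ) (m m' : ℤ) :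
    circleAt (m / (3 * (k + 4))) = circleAt (m' / (3 * (k + 4))) ↔ ∃ j, m = m' + 3 * (k + 4) * j := by
  rw [circleAt_eq_iff]
  refine exists_congr fun j => ?_
  rw [← Int.cast_inj (α := ℝ)]
  push_cast
  field_simp

lemma circleAt_div_eq_iff_of_lt (k : ℕ) {m m' : ℤ} (h0 : 0 ≤ m) (h1 : m < 3 * (k + 4))
    (h0' : 0 ≤ m') (h1' : m' < 3 * (k + 4)) :
    circleAt (m / (3 * (k + 4))) = circleAt (m' / (3 * (k + 4))) ↔ m = m' := by
  rw [circleAt_div_eq_iff]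
  constructor
  · rintro ⟨j, rfl⟩
    have h2 : j < 1 := by nlinarith
    have h3 : -1 < j := by nlinarith
    have : j = 0 := by omega
    simp [this]
  · rintro rfl
    exact ⟨0, by simp⟩

/-- Exponents of the points of `torusPoints k`. -/
noncomputable def grid (k : ℕ) : Finset (ℤ × ℤ) :=
  (Finset.Ico 0 (3 * ((k : ℤ) + 4)) ×ˢ Finset.Ico 0 (3 * ((k : ℤ) + 4))).filter fun q => 3 ∣ q.1 + q.2

lemma mem_grid {k : ℕ} {q : ℤ × ℤ} : q ∈ grid k ↔
    0 ≤ q.1 ∧ q.1 < 3 * (k + 4) ∧ 0 ≤ q.2 ∧ q.2 < 3 * (k + 4) ∧ 3 ∣ q.1 + q.2 := by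
  simp only [grid, Finset.mem_filter, Finset.mem_product, Finset.mem_Ico]
  tauto

lemma gridPoint_injOn (k : ℕ) : Set.InjOn (gridPoint k) (grid k) := by
  rintro ⟨a, b⟩ h ⟨c, d⟩ h' e
  simp only [Finset.mem_coe, mem_grid] at h h'
  simp only [gridPoint, Prod.mk.injEq] at e
  rw [circleAt_div_eq_iff_of_lt, circleAt_div_eq_iff_of_lt] at e
  · exact Prod.ext e.1 e.2
  all_goals omega

lemma torusPoints_eq_image (k : ℕ) : torusPoints k = gridPoint k '' grid k := by
  ext ω
  simp only [torusPoints, Set.mem_ofPred_eq, Set.mem_image, Finset.mem_coe, mem_grid]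
  constructor
  · rintro ⟨q₁, q₂, h1, h2, h3, rfl⟩
    refine ⟨(q₁, q₂), ⟨by simp, ?_, by simp, ?_, ?_⟩, by simp [gridPoint]⟩
    · simp only; omega
    · simp only; omega
    · have := Nat.modEq_zero_iff_dvd.mp h3
      simp only; omega
  · rintro ⟨⟨a, b⟩, ⟨h1, h2, h3, h4, h5⟩, rfl⟩
    simp only at h1 h2 h3 h4 h5
    lift a to ℕ using h1
    lift b to ℕ using h3
    refine ⟨a, b, by omega, by omega, Nat.modEq_zero_iff_dvd.mpr (by omega), by simp [gridPoint]⟩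

lemma emod_eq {m x N : ℤ} (j : ℤ) (h : x = m + N * j) (h0 : 0 ≤ m) (h1 : m < N) : x % N = m := by
  rw [h, Int.add_mul_emod_self_left, Int.emod_eq_of_lt h0 h1]

/-- Summation over the grid in the coordinates of the Dynkin labels. -/
lemma sum_grid_eq {M : Type*} [AddCommMonoid M] (k : ℕ) (H : Circle × Circle → M) :
    ∑ q ∈ grid k, H (gridPoint k q) = ∑ u ∈ Finset.Ico 0 (3 * ((k : ℤ) + 4)),
      ∑ v ∈ Finset.Ico 0 ((k : ℤ) + 4), H (weightPoint k (u, v)) := by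
  rw [← Finset.sum_product']
  symm
  -- Modulo 3(k+4) the exponents of the weight (u, v) are u + 3v and -u. Their sum is 3v, which
  -- explains the congruence condition on the grid and recovers v modulo k + 4.
  refine Finset.sum_nbij' (fun p => ((p.1 + 3 * p.2) % (3 * (k + 4)), (-p.1) % (3 * (k + 4))))
    (fun q => ((-q.2) % (3 * (k + 4)), ((q.1 + q.2) / 3) % (k + 4))) ?_ ?_ ?_ ?_ ?_
  · rintro ⟨u, v⟩ h
    simp only [Finset.mem_product, Finset.mem_Ico] at h
    rw [mem_grid]
    refine ⟨Int.emod_nonneg _ (by omega), Int.emod_lt_of_pos _ (by omega),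
      Int.emod_nonneg _ (by omega), Int.emod_lt_of_pos _ (by omega), ?_⟩
    simp only [Int.emod_def]
    exact ⟨v - (k + 4) * ((u + 3 * v) / (3 * (k + 4))) - (k + 4) * (-u / (3 * (k + 4))), by ring⟩
  · rintro ⟨a, b⟩ h
    rw [mem_grid] at h
    simp only [Finset.mem_product, Finset.mem_Ico]
    exact ⟨⟨Int.emod_nonneg _ (by omega), Int.emod_lt_of_pos _ (by omega)⟩,
      Int.emod_nonneg _ (by omega), Int.emod_lt_of_pos _ (by omega)⟩
  · rintro ⟨u, v⟩ h
    simp only [Finset.mem_product, Finset.mem_Ico] at h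
    simp only [Prod.mk.injEq]
    refine ⟨emod_eq (-u / (3 * (k + 4))) ?_ h.1.1 h.1.2,
      emod_eq (-((u + 3 * v) / (3 * (k + 4))) - (-u / (3 * (k + 4)))) ?_ h.2.1 h.2.2⟩
    · rw [Int.emod_def]; ring
    · rw [Int.emod_def, Int.emod_def]
      refine Int.ediv_eq_of_eq_mul_right (by norm_num) ?_
      ring
  · rintro ⟨a, b⟩ h
    rw [mem_grid] at h
    obtain ⟨h1, h2, h3, h4, c, hc⟩ := h
    simp only at h1 h2 h3 h4 hc
    have hc' : (a + b) / 3 = c := by omega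
    simp only [Prod.mk.injEq, hc']
    refine ⟨emod_eq (-(-b / (3 * (k + 4))) - c / (k + 4)) ?_ h1 h2,
      emod_eq (-b / (3 * (k + 4))) ?_ h3 h4⟩
    · rw [Int.emod_def, Int.emod_def]
      linear_combination -hc
    · rw [Int.emod_def]; ring
  · rintro ⟨u, v⟩ h
    rw [weightPoint_eq_gridPoint]
    congr 1
    simp only [gridPoint, Prod.mk.injEq]
    constructor
    · rw [circleAt_div_eq_iff]
      exact ⟨(u + 3 * v) / (3 * (k + 4)), (Int.emod_add_mul_ediv _ _).symm⟩
    · rw [circleAt_div_eq_iff]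
      exact ⟨(-u) / (3 * (k + 4)), (Int.emod_add_mul_ediv _ _).symm⟩

/-! ### Folding the grid onto the alcove -/

lemma sum_eq_sum_filter_add_sum_filter {ι M : Type*} [AddCommMonoid M] (s : Finset ι)
    (p r : ι → Prop) [DecidablePred p] [DecidablePred r] (f : ι → M)
    (disjoint : ∀ x ∈ s, p x → ¬ r x) (zero : ∀ x ∈ s, ¬ p x → ¬ r x → f x = 0) :
    ∑ x ∈ s, f x = ∑ x ∈ s with p x, f x + ∑ x ∈ s with r x, f x := by
  rw [Finset.sum_filter, Finset.sum_filter, ← Finset.sum_add_distrib]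
  refine Finset.sum_congr rfl fun x hx => ?_
  have := disjoint x hx
  have := zero x hx
  by_cases hp : p x <;> by_cases hr : r x <;> simp_all

lemma sum_grid_fold_diagonal {M : Type*} [AddCommMonoid M] (k : ℕ) (K : ℤ × ℤ → M)
    (flip : ∀ a b, K (b, a) = K (a, b)) (wall : ∀ a, K (a, a) = 0) :
    ∑ q ∈ grid k, K q = 2 • ∑ q ∈ grid k with q.2 < q.1, K q := by
  rw [sum_eq_sum_filter_add_sum_filter (grid k) (fun q => q.2 < q.1) (fun q => q.1 < q.2), two_nsmul]
  · congr 1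
    refine Finset.sum_nbij' (fun q => (q.2, q.1)) (fun q => (q.2, q.1)) ?_ ?_ ?_ ?_ ?_
    · rintro ⟨a, b⟩ h; simp only [Finset.mem_filter, mem_grid] at h ⊢; omega
    · rintro ⟨a, b⟩ h; simp only [Finset.mem_filter, mem_grid] at h ⊢; omega
    · rintro ⟨a, b⟩ h; rfl
    · rintro ⟨a, b⟩ h; rfl
    · rintro ⟨a, b⟩ h; exact (flip a b).symm
  · rintro ⟨a, b⟩ _ h; exact h.not_gt
  · rintro ⟨a, b⟩ _ h h'
    simp only at h h'
    obtain rfl : a = b := by omega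
    exact wall a

/-- The reflection (a, b) ↦ (N - b, N - a), N = 3(k+4), halves the triangle below the diagonal. The
edge b = 0 is treated as a wall of its own, because its image has first exponent N, outside the
chosen range. -/
lemma sum_grid_fold_antidiagonal {M : Type*} [AddCommMonoid M] (k : ℕ) (K : ℤ × ℤ → M)
    (swap : ∀ a b, K (3 * (k + 4) - b, 3 * (k + 4) - a) = K (a, b)) (wall : ∀ a, K (a, 0) = 0)
    (wall' : ∀ a b : ℤ, a + b = 3 * (k + 4) → K (a, b) = 0) :
    ∑ q ∈ grid k with q.2 < q.1, K q =
      2 • ∑ q ∈ grid k with q.2 < q.1 ∧ 0 < q.2 ∧ q.1 + q.2 < 3 * ((k : ℤ) + 4), K q := by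
  rw [sum_eq_sum_filter_add_sum_filter _ (fun q => 0 < q.2 ∧ q.1 + q.2 < 3 * ((k : ℤ) + 4))
    (fun q => 0 < q.2 ∧ 3 * ((k : ℤ) + 4) < q.1 + q.2), two_nsmul, Finset.filter_filter,
    Finset.filter_filter]
  · congr 1
    refine Finset.sum_nbij' (fun q => (3 * (k + 4) - q.2, 3 * (k + 4) - q.1))
      (fun q => (3 * (k + 4) - q.2, 3 * (k + 4) - q.1)) ?_ ?_ ?_ ?_ ?_
    · rintro ⟨a, b⟩ h; simp only [Finset.mem_filter, mem_grid] at h ⊢; omega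
    · rintro ⟨a, b⟩ h; simp only [Finset.mem_filter, mem_grid] at h ⊢; omega
    · rintro ⟨a, b⟩ h; simp
    · rintro ⟨a, b⟩ h; simp
    · rintro ⟨a, b⟩ h; exact (swap a b).symm
  · rintro ⟨a, b⟩ _ h
    simp only at h ⊢
    omega
  · rintro ⟨a, b⟩ h h1 h2
    simp only [Finset.mem_filter, mem_grid] at h h1 h2
    by_cases hb : b = 0
    · rw [hb, wall]
    · exact wall' a b (by omega)

/-- The lines a = 2b and 2a - b = 3(k+4) cut the remaining triangle into three alcoves. On each of
them the two labels, diminished by one, are read off from the distances to the walls. -/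
lemma sum_grid_three_tiles {M : Type*} [AddCommMonoid M] (k : ℕ) (K : ℤ × ℤ → M) (f : ℕ × ℕ → M)
    (tile₁ : ∀ x : ℕ × ℕ, K (2 * (x.1 + 1) + 3 * (x.2 + 1), (x.1 + 1) + 3 * (x.2 + 1)) = f x)
    (tile₂ : ∀ x : ℕ × ℕ, K (2 * (x.1 + 1) + 3 * (x.2 + 1), x.1 + 1) = f x)
    (tile₃ : ∀ x : ℕ × ℕ, K (3 * (k + 4) - ((x.1 + 1) + 3 * (x.2 + 1)), x.1 + 1) = f x)
    (wall : ∀ a b, a = 2 * b → K (a, b) = 0) (wall' : ∀ a b : ℤ, 2 * a - b = 3 * (k + 4) → K (a, b) = 0) :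
    ∑ q ∈ grid k with q.2 < q.1 ∧ 0 < q.2 ∧ q.1 + q.2 < 3 * ((k : ℤ) + 4), K q =
      3 • ∑ x ∈ alcove k, f x := by
  rw [sum_eq_sum_filter_add_sum_filter _ (fun q => q.1 < 2 * q.2) (fun q => 2 * q.2 < q.1),
    sum_eq_sum_filter_add_sum_filter (Finset.filter (fun q : ℤ × ℤ => 2 * q.2 < q.1) _)
      (fun q => 2 * q.1 - q.2 < 3 * ((k : ℤ) + 4)) (fun q => 3 * ((k : ℤ) + 4) < 2 * q.1 - q.2),
    Finset.filter_filter, Finset.filter_filter, Finset.filter_filter, Finset.filter_filter,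
    succ_nsmul, two_nsmul, add_assoc]
  · refine congrArg₂ (· + ·) ?_ (congrArg₂ (· + ·) ?_ ?_)
    · symm
      refine Finset.sum_nbij' (fun x => (2 * (x.1 + 1) + 3 * (x.2 + 1), (x.1 + 1) + 3 * (x.2 + 1)))
        (fun q => ((q.1 - q.2 - 1).toNat, ((2 * q.2 - q.1) / 3 - 1).toNat)) ?_ ?_ ?_ ?_ ?_
      · rintro ⟨a, b⟩ h; simp only [Finset.mem_filter, mem_grid, mem_alcove] at h ⊢; omega
      · rintro ⟨a, b⟩ h; simp only [Finset.mem_filter, mem_grid, mem_alcove] at h ⊢; omega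
      · rintro ⟨a, b⟩ h; simp only [Prod.mk.injEq]; omega
      · rintro ⟨a, b⟩ h
        simp only [Finset.mem_filter, mem_grid] at h
        simp only [Prod.mk.injEq]; omega
      · rintro x h; exact (tile₁ x).symm
    · symm
      refine Finset.sum_nbij' (fun x => (2 * (x.1 + 1) + 3 * (x.2 + 1), (x.1 + 1)))
        (fun q => ((q.2 - 1).toNat, ((q.1 - 2 * q.2) / 3 - 1).toNat)) ?_ ?_ ?_ ?_ ?_
      · rintro ⟨a, b⟩ h; simp only [Finset.mem_filter, mem_grid, mem_alcove] at h ⊢; omega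
      · rintro ⟨a, b⟩ h; simp only [Finset.mem_filter, mem_grid, mem_alcove] at h ⊢; omega
      · rintro ⟨a, b⟩ h; simp only [Prod.mk.injEq]; omega
      · rintro ⟨a, b⟩ h
        simp only [Finset.mem_filter, mem_grid] at h
        simp only [Prod.mk.injEq]; omega
      · rintro x h; exact (tile₂ x).symm
    · symm
      refine Finset.sum_nbij'
        (fun x => (3 * (k + 4) - ((x.1 + 1) + 3 * (x.2 + 1)), (x.1 + 1)))
        (fun q => ((q.2 - 1).toNat, ((3 * (k + 4) - q.1 - q.2) / 3 - 1).toNat)) ?_ ?_ ?_ ?_ ?_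
      · rintro ⟨a, b⟩ h; simp only [Finset.mem_filter, mem_grid, mem_alcove] at h ⊢; omega
      · rintro ⟨a, b⟩ h; simp only [Finset.mem_filter, mem_grid, mem_alcove] at h ⊢; omega
      · rintro ⟨a, b⟩ h; simp only [Prod.mk.injEq]; omega
      · rintro ⟨a, b⟩ h
        simp only [Finset.mem_filter, mem_grid] at h
        simp only [Prod.mk.injEq]; omega
      · rintro x h; exact (tile₃ x).symm
  · rintro ⟨a, b⟩ _ h; exact h.not_gt
  · rintro ⟨a, b⟩ _ h h'
    exact wall' a b (by simp only at h h'; omega)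
  · rintro ⟨a, b⟩ _ h; exact h.not_gt
  · rintro ⟨a, b⟩ _ h h'
    exact wall a b (by simp only at h h'; omega)

/-- Summation over the grid of a function invariant under the Weyl group that vanishes on the walls:
the grid consists of the walls and of twelve copies of the alcove. -/
lemma sum_grid_eq_nsmul_sum_alcove {M : Type*} [AddCommMonoid M] (k : ℕ) (H : Circle × Circle → M)
    (swap : ∀ a b, H (b⁻¹, a⁻¹) = H (a, b)) (rotate : ∀ a b, H (b, a⁻¹ * b) = H (a, b))
    (wall : ∀ ω, jacobian ω = 0 → H ω = 0) :
    ∑ q ∈ grid k, H (gridPoint k q) = 12 • ∑ x ∈ alcove k, H (weightPoint k (shifted x)) := by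
  have wall' : ∀ a b : ℤ, (∃ m : ℤ, a = 3 * (k + 4) * m ∨ b = 3 * (k + 4) * m ∨
      a + b = 3 * (k + 4) * m ∨ a - b = 3 * (k + 4) * m ∨ 2 * a - b = 3 * (k + 4) * m ∨
      a - 2 * b = 3 * (k + 4) * m) → H (gridPoint k (a, b)) = 0 := by
    rintro a b ⟨m, h⟩
    refine wall _ ?_
    have hs : ∀ x : ℝ, x * (3 * (k + 4)) = 3 * (k + 4) * m → Real.sin (Real.pi * x) = 0 := by
      intro x hx
      have : x = m := by
        have h0 : (3 * ((k : ℝ) + 4)) ≠ 0 := by positivity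
        exact mul_right_cancel₀ h0 (by linarith)
      rw [this, mul_comm, Real.sin_int_mul_pi]
    rw [gridPoint, jacobian_eq_prod_sin]
    simp only [← @Int.cast_inj ℝ] at h
    push_cast at h
    rcases h with h | h | h | h | h | h
    · rw [hs (a / _) (by field_simp; linarith)]; ring
    · rw [hs (b / _) (by field_simp; linarith)]; ring
    · rw [hs (a / _ + b / _) (by field_simp; linarith)]; ring
    · rw [hs (a / _ - b / _) (by field_simp; linarith)]; ring
    · rw [hs (2 * (a / _) - b / _) (by field_simp; linarith)]; ring
    · rw [hs (a / _ - 2 * (b / _)) (by field_simp; linarith)]; ring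
  have periodic : ∀ a b i j : ℤ, H (gridPoint k (a + 3 * (k + 4) * i, b + 3 * (k + 4) * j)) =
      H (gridPoint k (a, b)) := by
    intro a b i j
    congr 1
    simp only [gridPoint, Prod.mk.injEq]
    exact ⟨(circleAt_div_eq_iff _ _ _).mpr ⟨i, rfl⟩, (circleAt_div_eq_iff _ _ _).mpr ⟨j, rfl⟩⟩
  have swap' : ∀ a b : ℤ, H (gridPoint k (-b, -a)) = H (gridPoint k (a, b)) := by
    intro a b
    rw [← swap]
    simp only [gridPoint, ← circleAt_neg]
    push_cast
    simp only [neg_div, neg_neg]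
  have rotate' : ∀ a b : ℤ, H (gridPoint k (b, b - a)) = H (gridPoint k (a, b)) := by
    intro a b
    simp only [gridPoint]
    rw [← rotate (circleAt (a / _)), ← circleAt_neg, ← circleAt_add]
    push_cast
    simp only [sub_div, neg_add_eq_sub]
  have neg' : ∀ a b : ℤ, H (gridPoint k (-a, -b)) = H (gridPoint k (a, b)) := by
    intro a b
    rw [← rotate' a b, ← rotate' b, ← rotate' (b - a)]
    congr 2
    refine Prod.ext ?_ ?_ <;> simp only <;> ring
  have flip : ∀ a b : ℤ, H (gridPoint k (b, a)) = H (gridPoint k (a, b)) := by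
    intro a b
    rw [← swap' a b, ← neg' b a]
  have inner : ∀ x : ℕ × ℕ, H (gridPoint k ((x.1 + 1) + 3 * (x.2 + 1), -(x.1 + 1))) =
      H (weightPoint k (shifted x)) := fun x => by rw [weightPoint_eq_gridPoint]; rfl
  -- The order of the Weyl group appears as 12 = 2 · 2 · 3.
  rw [sum_grid_fold_diagonal k (fun q => H (gridPoint k q)) flip fun a => wall' a a ⟨0, by omega⟩,
    sum_grid_fold_antidiagonal k (fun q => H (gridPoint k q)),
    sum_grid_three_tiles k (fun q => H (gridPoint k q)) fun x => H (weightPoint k (shifted x)),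
    ← mul_nsmul, ← mul_nsmul]
  · intro x
    refine Eq.trans ?_ (((rotate' _ _).trans (rotate' _ _)).trans ((neg' _ _).trans (inner x)))
    congr 3 <;> ring
  · intro x
    refine Eq.trans ?_ (((rotate' _ _).trans (rotate' _ _)).trans ((flip _ _).trans (inner x)))
    congr 3 <;> ring
  · intro x
    refine Eq.trans ?_ (((periodic _ _ 1 0).trans (neg' _ _)).trans (inner x))
    congr 3; ring
  · exact fun a b h => wall' a b ⟨0, by omega⟩
  · exact fun a b h => wall' a b ⟨1, by omega⟩
  · intro a b
    refine Eq.trans ?_ ((periodic (-b) (-a) 1 1).trans (swap' a b))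
    congr 3 <;> ring
  · exact fun a => wall' a 0 ⟨0, by omega⟩
  · exact fun a b h => wall' a b ⟨1, by omega⟩

/-! ### The norm of the alternating sum on the grid -/

lemma sum_Ico_zpow_eq_zero {z : ℂ} {N : ℕ} (hN : z ^ N = 1) (hz : z ≠ 1) :
    ∑ u ∈ Finset.Ico (0 : ℤ) N, z ^ u = 0 := by
  have h : ∑ u ∈ Finset.Ico (0 : ℤ) N, z ^ u = ∑ u ∈ Finset.range N, z ^ u := by
    refine Finset.sum_nbij' Int.toNat (fun m => (m : ℤ)) ?_ ?_ ?_ ?_ ?_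
    · intro a h; simp only [Finset.mem_Ico, Finset.mem_range] at h ⊢; omega
    · intro a h; simp only [Finset.mem_Ico, Finset.mem_range] at h ⊢; omega
    · intro a h; simp only [Finset.mem_Ico] at h; omega
    · intro a h; simp
    · intro a h
      simp only [Finset.mem_Ico] at h
      rw [← zpow_natCast, Int.toNat_of_nonneg h.1]
  have h2 := geom_sum_mul z N
  rw [hN, sub_self] at h2
  rw [h]
  exact (mul_eq_zero.mp h2).resolve_right (sub_ne_zero.mpr hz)

/-- The sum over the grid of a character. -/
lemma sum_gridCos (k : ℕ) (α β : ℤ) : ∑ u ∈ Finset.Ico 0 (3 * ((k : ℤ) + 4)),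
    ∑ v ∈ Finset.Ico 0 ((k : ℤ) + 4), gridCos k (α * u + 3 * β * v) =
      if 3 * ((k : ℤ) + 4) ∣ α ∧ (k : ℤ) + 4 ∣ β then 3 * ((k : ℝ) + 4) ^ 2 else 0 := by
  set ζ := Complex.exp (2 * Real.pi * Complex.I / (3 * (k + 4) : ℕ)) with hζ
  have hp : IsPrimitiveRoot ζ (3 * (k + 4)) := Complex.isPrimitiveRoot_exp _ (by omega)
  have hζ0 : ζ ≠ 0 := Complex.exp_ne_zero _
  have hg : ∀ m : ℤ, gridCos k m = (ζ ^ m).re := by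
    intro m
    rw [hζ, ← Complex.exp_int_mul, gridCos, ← Complex.exp_ofReal_mul_I_re]
    congr 2; push_cast; ring
  have hs : ∑ u ∈ Finset.Ico 0 (3 * ((k : ℤ) + 4)), ∑ v ∈ Finset.Ico 0 ((k : ℤ) + 4),
      gridCos k (α * u + 3 * β * v) = ((∑ u ∈ Finset.Ico (0 : ℤ) (3 * (k + 4) : ℕ), (ζ ^ α) ^ u)
        * ∑ v ∈ Finset.Ico (0 : ℤ) (k + 4 : ℕ), (ζ ^ (3 * β)) ^ v).re := by
    rw [Finset.sum_mul_sum, Complex.re_sum]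
    refine Finset.sum_congr rfl fun u _ => ?_
    rw [Complex.re_sum]
    refine Finset.sum_congr rfl fun v _ => ?_
    rw [hg, zpow_add₀ hζ0, zpow_mul, zpow_mul]
  have h1 : ζ ^ α = 1 ↔ 3 * ((k : ℤ) + 4) ∣ α := by
    rw [hp.zpow_eq_one_iff_dvd]; push_cast; rfl
  have h2 : ζ ^ (3 * β) = 1 ↔ (k : ℤ) + 4 ∣ β := by
    rw [hp.zpow_eq_one_iff_dvd]; push_cast
    exact mul_dvd_mul_iff_left (by norm_num)
  rw [hs]
  split_ifs with h
  · rw [h1.mpr h.1, h2.mpr h.2]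
    simp
    norm_cast
    ring
  · rcases not_and_or.mp h with h | h
    · rw [sum_Ico_zpow_eq_zero _ (mt h1.mp h), zero_mul, Complex.zero_re]
      rw [← zpow_natCast, ← zpow_mul, hp.zpow_eq_one_iff_dvd]
      exact dvd_mul_left _ _
    · rw [sum_Ico_zpow_eq_zero (N := k + 4) _ (mt h2.mp h), mul_zero, Complex.zero_re]
      rw [← zpow_natCast, ← zpow_mul, hp.zpow_eq_one_iff_dvd]
      exact ⟨β, by push_cast; ring⟩

/-- First coefficients of `weylPairing x (1, 1)`. -/
def rhoCoeff₁ : Fin 6 → ℤ := ![5, -4, -1, -4, 5, -1]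

/-- Second coefficients of `weylPairing x (1, 1)`, divided by 3. -/
def rhoCoeff₂ : Fin 6 → ℤ := ![3, -1, -2, -3, 2, 1]

lemma weylPairing_rho (u v : ℤ) (i : Fin 6) : weylPairing (u, v) (1, 1) i =
    rhoCoeff₁ i * u
      + 3 * rhoCoeff₂ i * v := by
  fin_cases i <;> simp [weylPairing, rhoCoeff₁, rhoCoeff₂] <;> ring

/-- The six cosines remain orthogonal on the grid of 3(k+4)² points, each with mean square 1/2, so
the sum is 6 · ½ · 3(k+4)². -/
lemma sum_altSum_rho_sq (k : ℕ) : ∑ u ∈ Finset.Ico 0 (3 * ((k : ℤ) + 4)),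
    ∑ v ∈ Finset.Ico 0 ((k : ℤ) + 4), altSum k (u, v) (1, 1) ^ 2 = 9 * ((k : ℝ) + 4) ^ 2 := by
  have hsq : ∀ u v : ℤ, altSum k (u, v) (1, 1) ^ 2 = ∑ i, ∑ j, weylSign i * weylSign j *
      ((gridCos k ((rhoCoeff₁ i + rhoCoeff₁ j) * u
        + 3 * (rhoCoeff₂ i + rhoCoeff₂ j) * v)
      + gridCos k ((rhoCoeff₁ i - rhoCoeff₁ j) * u
        + 3 * (rhoCoeff₂ i - rhoCoeff₂ j) * v)) / 2) := by
    intro u v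
    rw [sq, altSum, Finset.sum_mul_sum]
    refine Finset.sum_congr rfl fun i _ => Finset.sum_congr rfl fun j _ => ?_
    have h := gridCos_add_add_sub k (weylPairing (u, v) (1, 1) i) (weylPairing (u, v) (1, 1) j)
    have e1 : weylPairing (u, v) (1, 1) i + weylPairing (u, v) (1, 1) j =
      (rhoCoeff₁ i + rhoCoeff₁ j) * u
        + 3 * (rhoCoeff₂ i + rhoCoeff₂ j) * v := by
      rw [weylPairing_rho, weylPairing_rho]; ring
    have e2 : weylPairing (u, v) (1, 1) i - weylPairing (u, v) (1, 1) j =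
      (rhoCoeff₁ i - rhoCoeff₁ j) * u
        + 3 * (rhoCoeff₂ i - rhoCoeff₂ j) * v := by
      rw [weylPairing_rho, weylPairing_rho]; ring
    rw [← e1, ← e2, h]
    ring
  simp only [hsq]
  have hswap : ∀ f : ℤ → ℤ → Fin 6 → Fin 6 → ℝ, ∑ u ∈ Finset.Ico 0 (3 * ((k : ℤ) + 4)),
      ∑ v ∈ Finset.Ico 0 ((k : ℤ) + 4), ∑ i, ∑ j, f u v i j = ∑ i, ∑ j,
      ∑ u ∈ Finset.Ico 0 (3 * ((k : ℤ) + 4)), ∑ v ∈ Finset.Ico 0 ((k : ℤ) + 4), f u v i j := by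
    have hc : ∀ (s : Finset ℤ) (g : ℤ → Fin 6 → Fin 6 → ℝ),
        ∑ x ∈ s, ∑ i, ∑ j, g x i j = ∑ i, ∑ j, ∑ x ∈ s, g x i j := fun s g =>
      Finset.sum_comm.trans (Finset.sum_congr rfl fun i _ => Finset.sum_comm)
    intro f
    rw [Finset.sum_congr rfl fun u _ => hc _ (f u), hc]
  rw [hswap]
  simp only [← Finset.mul_sum, ← Finset.sum_div, Finset.sum_add_distrib, sum_gridCos]
  -- The grid is fine enough to separate these frequencies: coefficients up to 10 stay below 3(k+4)
  -- ≥ 12. In the next claim, differences up to 3 stay below k + 4.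
  have hz : ∀ i j : Fin 6, ¬ (3 * ((k : ℤ) + 4) ∣
      rhoCoeff₁ i + rhoCoeff₁ j ∧
      (k : ℤ) + 4 ∣ rhoCoeff₂ i + rhoCoeff₂ j) := by
    rintro i j ⟨h, -⟩
    have h1 : ∀ i j, |rhoCoeff₁ i + rhoCoeff₁ j| ≤ 10 ∧ rhoCoeff₁ i + rhoCoeff₁ j ≠ 0 := by decide
    have h2 := h1 i j
    exact h2.2 (Int.eq_zero_of_abs_lt_dvd h (by omega))
  have hd : ∀ i j : Fin 6, (3 * ((k : ℤ) + 4) ∣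
      rhoCoeff₁ i - rhoCoeff₁ j ∧
      (k : ℤ) + 4 ∣ rhoCoeff₂ i - rhoCoeff₂ j)
      ↔ i = j := by
    intro i j
    have h1 : ∀ i j, |rhoCoeff₁ i - rhoCoeff₁ j| ≤ 10 ∧ (rhoCoeff₁ i - rhoCoeff₁ j = 0 →
      |rhoCoeff₂ i - rhoCoeff₂ j| ≤ 3 ∧ (rhoCoeff₂ i - rhoCoeff₂ j = 0 → i = j)) := by decide
    constructor
    · rintro ⟨h, h'⟩
      have h2 := h1 i j
      have h3 := h2.2 (Int.eq_zero_of_abs_lt_dvd h (by omega))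
      exact h3.2 (Int.eq_zero_of_abs_lt_dvd h' (by omega))
    · rintro rfl
      simp
  simp only [hz, hd, if_false, zero_add, Finset.sum_ite_eq, mul_ite, ite_div, zero_div, mul_zero,
    Finset.mem_univ, if_true]
  simp [Fin.sum_univ_succ, weylSign]
  ring

lemma sum_alcove_jacobian_sq (k : ℕ) : ∑ x ∈ alcove k, jacobian (weightPoint k (shifted x)) ^ 2 =
    48 * ((k : ℝ) + 4) ^ 2 * Real.pi ^ 4 := by
  have h := sum_grid_eq_nsmul_sum_alcove k (fun ω => jacobian ω ^ 2)
    (fun a b => by rw [jacobian_swap, neg_sq]) (fun a b => by rw [jacobian_rotate])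
    (fun ω h => by rw [h]; ring)
  rw [sum_grid_eq k (fun ω => jacobian ω ^ 2)] at h
  simp only [jacobian_weightPoint, mul_pow, ← Finset.mul_sum, sum_altSum_rho_sq] at h ⊢
  rw [nsmul_eq_mul] at h
  push_cast at h
  linarith

/-! ### The points of the alcove -/

/-- Up to sign, the six sines have arguments π y / 3(k+4) with 0 < y < 3(k+4): points of the shifted
alcove lie on no wall. -/
lemma jacobian_weightPoint_ne_zero {k : ℕ} {x : ℕ × ℕ} (hx : x ∈ alcove k) :
    jacobian (weightPoint k (shifted x)) ≠ 0 := by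
  have hx' : (x.1 : ℝ) + 2 * x.2 ≤ k := by exact_mod_cast mem_alcove.mp hx
  have hs : ∀ y : ℝ, 0 < y → y < 3 * (k + 4) → Real.sin (Real.pi * (y / (3 * (k + 4)))) ≠ 0 := by
    intro y h0 h1
    refine (Real.sin_pos_of_pos_of_lt_pi (by positivity) ?_).ne'
    have : y / (3 * (k + 4)) < 1 := (div_lt_one (by positivity)).mpr h1
    nlinarith [Real.pi_pos]
  have h1 : (0 : ℝ) ≤ x.1 := Nat.cast_nonneg _
  have h2 : (0 : ℝ) ≤ x.2 := Nat.cast_nonneg _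
  set N : ℝ := 3 * (k + 4) with hN
  rw [weightPoint, jacobian_eq_prod_sin]
  simp only [shifted]
  push_cast
  rw [show Real.pi * (-((x.1 : ℝ) + 1) / N) = -(Real.pi * ((x.1 + 1) / N)) by ring, Real.sin_neg,
    show ((x.1 : ℝ) + 1 + 3 * (x.2 + 1)) / N + -(x.1 + 1) / N = 3 * (x.2 + 1) / N by ring,
    show ((x.1 : ℝ) + 1 + 3 * (x.2 + 1)) / N - -(x.1 + 1) / N
      = (2 * (x.1 + 1) + 3 * (x.2 + 1)) / N by ring,
    show 2 * (((x.1 : ℝ) + 1 + 3 * (x.2 + 1)) / N) - -(x.1 + 1) / N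
      = (3 * (x.1 + 1) + 6 * (x.2 + 1)) / N by ring,
    show ((x.1 : ℝ) + 1 + 3 * (x.2 + 1)) / N - 2 * (-(x.1 + 1) / N)
      = (3 * (x.1 + 1) + 3 * (x.2 + 1)) / N by ring]
  have p1 := hs (x.1 + 1 + 3 * (x.2 + 1)) (by linarith) (by linarith)
  have p2 := hs (x.1 + 1) (by linarith) (by linarith)
  have p3 := hs (3 * (x.2 + 1)) (by linarith) (by linarith)
  have p4 := hs (2 * (x.1 + 1) + 3 * (x.2 + 1)) (by linarith) (by linarith)
  have p5 := hs (3 * (x.1 + 1) + 6 * (x.2 + 1)) (by linarith) (by linarith)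
  have p6 := hs (3 * (x.1 + 1) + 3 * (x.2 + 1)) (by linarith) (by linarith)
  have := Real.pi_ne_zero
  simp_all

/-- The joint eigenvalues of distinct vertices are distinct. -/
lemma chi_weightPoint_injective {k : ℕ} {x y : ℕ × ℕ} (hx : x ∈ alcove k) (hy : y ∈ alcove k)
    (h1 : chi₁ (weightPoint k (shifted x)) = chi₁ (weightPoint k (shifted y)))
    (h2 : chi₂ (weightPoint k (shifted x)) = chi₂ (weightPoint k (shifted y))) : x = y := by
  rw [mem_alcove] at hx hy
  have hper : ∀ m : ℤ, circleAt ((3 * (k + 4) - m : ℤ) / (3 * (k + 4))) =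
      (circleAt (m / (3 * (k + 4))))⁻¹ := by
    intro m
    rw [← circleAt_neg, circleAt_eq_iff]
    exact ⟨1, by push_cast; field_simp; ring⟩
  have hw : ∀ x : ℕ × ℕ, weightPoint k (shifted x) =
      (circleAt (((x.1 + 1) + 3 * (x.2 + 1) : ℤ) / (3 * (k + 4))),
        (circleAt ((x.1 + 1 : ℤ) / (3 * (k + 4))))⁻¹) := by
    intro x
    rw [weightPoint, shifted, ← circleAt_neg, neg_div]
    push_cast
    rfl
  have h3 : ((circleAt (((x.1 + 1) + 3 * (x.2 + 1) : ℤ) / (3 * (k + 4)))) *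
      (circleAt ((x.1 + 1 : ℤ) / (3 * (k + 4)))))⁻¹ =
      circleAt ((3 * (k + 4) - (2 * (x.1 + 1) + 3 * (x.2 + 1)) : ℤ) / (3 * (k + 4))) := by
    rw [hper, ← circleAt_add]
    congr 2; push_cast; ring
  -- Put u = x₁ + 1, v = x₂ + 1 and N = 3(k+4). The three eigenvalues have exponents u < u + 3v < N
  -- - (2u + 3v), all in the range from 0 to N, so the unordered triple determines u and v. In the
  -- conjugate case the exponents add up to 2N instead of N, which is impossible.
  rcases tripleSum_eq_or_of_chi_eq h1 h2 with h | h
  · rw [hw, hw, tripleSum, tripleSum] at h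
    simp only [inv_inv] at h
    have h' := circle_triple_of_sum_eq h
    rw [h3] at h'
    simp (discharger := omega) only [circleAt_div_eq_iff_of_lt] at h'
    refine Prod.ext ?_ ?_ <;> omega
  · rw [hw, hw, tripleSum, tripleSum] at h
    simp only [inv_inv] at h
    simp only [← hper] at h
    have h' := circle_triple_of_sum_eq h
    rw [h3] at h'
    simp (discharger := omega) only [circleAt_div_eq_iff_of_lt] at h'
    refine Prod.ext ?_ ?_ <;> omega

/-! ### The modular `S`-matrix -/

/-- A symmetric matrix whose columns are joint eigenvectors of two symmetric matrices with simple joint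
spectrum squares to a scalar, if one of its rows has no zero. -/
lemma mul_self_eq_smul_one_of_simple_joint_spectrum {ι : Type*} [Fintype ι] [DecidableEq ι]
    {S A B : Matrix ι ι ℝ} {a b : ι → ℝ} (hS : S.transpose = S) (hA : A.transpose = A)
    (hB : B.transpose = B) (hAS : A * S = S * Matrix.diagonal a) (hBS : B * S = S * Matrix.diagonal b)
    (simple : ∀ i j, a i = a j → b i = b j → i = j) {o : ι} (ho : ∀ i, S o i ≠ 0) :
    S * S = (S * S) o o • (1 : Matrix ι ι ℝ) := by
  have comm : ∀ {C : Matrix ι ι ℝ} {c : ι → ℝ}, C.transpose = C → C * S = S * Matrix.diagonal c →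
      ∀ i j, c i * (S * S) i j = (S * S) i j * c j := by
    intro C c hC h i j
    have h' : S * C = Matrix.diagonal c * S := by
      have := congrArg Matrix.transpose h
      rwa [Matrix.transpose_mul, Matrix.transpose_mul, hS, hC, Matrix.diagonal_transpose] at this
    have h2 : Matrix.diagonal c * (S * S) = S * S * Matrix.diagonal c := by
      rw [← Matrix.mul_assoc, ← h', Matrix.mul_assoc, h, Matrix.mul_assoc]
    have := congrFun (congrFun h2 i) j
    rwa [Matrix.diagonal_mul, Matrix.mul_diagonal] at this
  have diag : ∀ i j, i ≠ j → (S * S) i j = 0 := by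
    intro i j hij
    by_contra h0
    refine hij (simple i j ?_ ?_)
    · exact mul_right_cancel₀ h0 ((comm hA hAS i j).trans (mul_comm _ _))
    · exact mul_right_cancel₀ h0 ((comm hB hBS i j).trans (mul_comm _ _))
  have hd : S * S = Matrix.diagonal fun i => (S * S) i i := by
    ext i j
    by_cases hij : i = j
    · subst hij; simp
    · rw [diag i j hij, Matrix.diagonal_apply_ne _ hij]
  -- Row o of (S²)S = S(S²), with S² known to be diagonal, compares the entries at o and j after
  -- division by S o j.
  have const : ∀ j, (S * S) j j = (S * S) o o := by
    intro j
    have h : S * S * S = S * (S * S) := Matrix.mul_assoc _ _ _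
    have := congrFun (congrFun h o) j
    rw [hd, Matrix.diagonal_mul, Matrix.mul_diagonal] at this
    exact (mul_right_cancel₀ (ho j) (this.trans (mul_comm _ _))).symm
  rw [Matrix.smul_one_eq_diagonal]
  exact hd.trans (congrArg _ (funext const))

lemma kacPetersonS_eq (k : ℕ) (l m : ℕ × ℕ) : kacPetersonS k l m =
    (-2) / ((k + 4) * Real.sqrt 3) * altSum k (shifted l) (shifted m) := by
  rw [kacPetersonS, altSum_eq]
  have h : ∀ (x y : ℤ × ℤ) (i : Fin 6), gridCos k (weylPairing x y i) =
      Real.cos (2 * (Real.pi / (3 * (k + 4))) * (weylPairing x y i)) := by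
    intro x y i
    rw [gridCos]; ring_nf
  simp only [h]
  simp only [weylPairing, shifted, Fin.isValue, Matrix.cons_val]
  push_cast
  rfl

lemma kacPetersonS_comm (k : ℕ) (l m : ℕ × ℕ) : kacPetersonS k l m = kacPetersonS k m l := by
  rw [kacPetersonS_eq, kacPetersonS_eq, altSum_comm]

lemma kacPetersonS_zero (k : ℕ) (l : ℕ × ℕ) : kacPetersonS k l (0, 0) =
    -1 / (4 * Real.sqrt 3 * (k + 4) * Real.pi ^ 2) * jacobian (weightPoint k (shifted l)) := by
  rw [kacPetersonS_eq, jacobian_weightPoint]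
  simp only [shifted, Nat.cast_zero, zero_add]
  field_simp
  ring

lemma kacPetersonS_zero_ne_zero {k : ℕ} {l : ℕ × ℕ} (hl : l ∈ alcove k) :
    kacPetersonS k l (0, 0) ≠ 0 := by
  rw [kacPetersonS_zero]
  refine mul_ne_zero (div_ne_zero (by norm_num) ?_) (jacobian_weightPoint_ne_zero hl)
  positivity

lemma kacPetersonS_zero_sq (k : ℕ) (l : ℕ × ℕ) : kacPetersonS k l (0, 0) ^ 2 =
    jacobian (weightPoint k (shifted l)) ^ 2 / (48 * (k + 4) ^ 2 * Real.pi ^ 4) := by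
  have h : Real.sqrt 3 ^ 2 = 3 := Real.sq_sqrt (by norm_num)
  rw [kacPetersonS_zero, mul_pow, div_pow, mul_pow, mul_pow, mul_pow, h]
  field_simp
  ring

/-- The eigenvalue of the first graph at the vertex `x`. -/
noncomputable def eigenvalue₁ (k : ℕ) (x : alcove k) : ℝ := chi₁ (weightPoint k (shifted x))

/-- The eigenvalue of the second graph at the vertex `x`. -/
noncomputable def eigenvalue₂ (k : ℕ) (x : alcove k) : ℝ := chi₂ (weightPoint k (shifted x))

lemma sMatrix_transpose (k : ℕ) : (sMatrix k).transpose = sMatrix k := by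
  ext i j
  exact kacPetersonS_comm k _ _

lemma fusionGraph₁_mul_sMatrix (k : ℕ) : (fusionGraph₁ k).map (fun n : ℕ => (n : ℝ)) * sMatrix k =
    sMatrix k * Matrix.diagonal (eigenvalue₁ k) := by
  ext i j
  have h := sum_fusionGraph₁_mul_altSum k (shifted j) i
  rw [Matrix.mul_diagonal, Matrix.mul_apply, eigenvalue₁]
  simp only [Matrix.map_apply, sMatrix, Matrix.of_apply, kacPetersonS_eq,
    altSum_comm k _ (shifted j)]
  rw [mul_assoc, mul_comm (altSum _ _ _), ← h, Finset.mul_sum]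
  exact Finset.sum_congr rfl fun x _ => by ring

lemma fusionGraph₂_mul_sMatrix {k : ℕ} (hk : 1 ≤ k) :
    (fusionGraph₂ k).map (fun n : ℕ => (n : ℝ)) * sMatrix k =
    sMatrix k * Matrix.diagonal (eigenvalue₂ k) := by
  ext i j
  have h := sum_fusionGraph₂_mul_altSum hk (shifted j) i
  rw [Matrix.mul_diagonal, Matrix.mul_apply, eigenvalue₂]
  simp only [Matrix.map_apply, sMatrix, Matrix.of_apply, kacPetersonS_eq,
    altSum_comm k _ (shifted j)]
  rw [mul_assoc, mul_comm (altSum _ _ _), ← h, Finset.mul_sum]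
  exact Finset.sum_congr rfl fun x _ => by ring

lemma eigenvalue_injective {k : ℕ} {x y : alcove k} (h1 : eigenvalue₁ k x = eigenvalue₁ k y)
    (h2 : eigenvalue₂ k x = eigenvalue₂ k y) : x = y :=
  Subtype.ext (chi_weightPoint_injective x.2 y.2 h1 h2)

lemma sum_kacPetersonS_zero_sq (k : ℕ) : ∑ x : alcove k, kacPetersonS k x (0, 0) ^ 2 = 1 := by
  rw [Finset.sum_coe_sort (alcove k) (fun x => kacPetersonS k x (0, 0) ^ 2)]
  simp only [kacPetersonS_zero_sq, ← Finset.sum_div]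
  rw [sum_alcove_jacobian_sq]
  exact div_self (by positivity)

/-- Simplicity of the joint spectrum reduces this to the norm of the vacuum row, where the sum of J²
over the alcove enters. -/
lemma sMatrix_mul_self {k : ℕ} (hk : 1 ≤ k) : sMatrix k * sMatrix k = 1 := by
  have h := mul_self_eq_smul_one_of_simple_joint_spectrum (sMatrix_transpose k)
    (by ext i j; simp [fusionGraph₁_comm k j i]) (by ext i j; simp [fusionGraph₂_comm k j i])
    (fusionGraph₁_mul_sMatrix k) (fusionGraph₂_mul_sMatrix hk)
    (fun i j => eigenvalue_injective) (o := vacuum k)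
    (fun i => by
      rw [sMatrix, Matrix.of_apply, kacPetersonS_comm]
      exact kacPetersonS_zero_ne_zero i.2)
  have h1 : (sMatrix k * sMatrix k) (vacuum k) (vacuum k) = 1 := by
    rw [← sum_kacPetersonS_zero_sq k, Matrix.mul_apply]
    refine Finset.sum_congr rfl fun x _ => ?_
    simp only [sMatrix, Matrix.of_apply, vacuum]
    rw [kacPetersonS_comm, sq]
  rw [h, h1, one_smul]

/-! ### Diagonalisation of the graphs and the Verlinde formula -/

lemma fusionGraph₁_eq {k : ℕ} (hk : 1 ≤ k) : (fusionGraph₁ k).map (fun n : ℕ => (n : ℝ)) =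
    sMatrix k * Matrix.diagonal (eigenvalue₁ k) * sMatrix k := by
  rw [← fusionGraph₁_mul_sMatrix, Matrix.mul_assoc, sMatrix_mul_self hk, Matrix.mul_one]

lemma fusionGraph₂_eq {k : ℕ} (hk : 1 ≤ k) : (fusionGraph₂ k).map (fun n : ℕ => (n : ℝ)) =
    sMatrix k * Matrix.diagonal (eigenvalue₂ k) * sMatrix k := by
  rw [← fusionGraph₂_mul_sMatrix hk, Matrix.mul_assoc, sMatrix_mul_self hk, Matrix.mul_one]

lemma verlindeMatrix_eq {k : ℕ} {l : ℕ × ℕ} {d : alcove k → ℝ}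
    (h : ∀ x : alcove k, kacPetersonS k x l = d x * kacPetersonS k x (0, 0)) :
    verlindeMatrix k l = sMatrix k * Matrix.diagonal d * sMatrix k := by
  ext x y
  rw [verlindeMatrix, Matrix.of_apply, Matrix.mul_apply]
  refine Finset.sum_congr rfl fun s _ => ?_
  rw [Matrix.mul_diagonal, h, mul_div_cancel_right₀ _ (kacPetersonS_zero_ne_zero s.2), sMatrix,
    Matrix.of_apply, Matrix.of_apply, kacPetersonS_comm k x]
  ring

lemma fusionGraph₁_eq_verlindeMatrix {k : ℕ} (hk : 1 ≤ k) :
    (fusionGraph₁ k).map (fun n : ℕ => (n : ℝ)) = verlindeMatrix k (1, 0) := by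
  rw [fusionGraph₁_eq hk, verlindeMatrix_eq]
  intro x
  have h := altSum_short_weight k (shifted x)
  simp only [kacPetersonS_eq, eigenvalue₁]
  have e1 : shifted (1, 0) = (2, 1) := rfl
  have e2 : shifted (0, 0) = (1, 1) := rfl
  rw [e1, e2, h]
  ring

lemma fusionGraph₂_eq_verlindeMatrix {k : ℕ} (hk : 1 ≤ k) :
    (fusionGraph₂ k).map (fun n : ℕ => (n : ℝ)) = verlindeMatrix k (0, 1) := by
  rw [fusionGraph₂_eq hk, verlindeMatrix_eq]
  intro x
  have h := altSum_long_weight k (shifted x)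
  simp only [kacPetersonS_eq, eigenvalue₂]
  have e1 : shifted (0, 1) = (1, 2) := rfl
  have e2 : shifted (0, 0) = (1, 1) := rfl
  rw [e1, e2, h]
  ring

/-! ### Uniqueness of joint spectral measures -/

lemma measure_eq_of_finite_support {α : Type*} [MeasurableSpace α] [MeasurableSingletonClass α]
    {μ ν : Measure α} {F : Finset α} (hμ : ∀ᵐ x ∂μ, x ∈ F) (hν : ∀ᵐ x ∂ν, x ∈ F)
    (h : ∀ x ∈ F, μ {x} = ν {x}) : μ = ν := by
  classical
  have key : ∀ {m : Measure α}, (∀ᵐ x ∂m, x ∈ F) → ∀ t, MeasurableSet t →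
      m t = ∑ x ∈ F with x ∈ t, m {x} := by
    intro m hm t ht
    rw [sum_measure_singleton]
    refine measure_congr ?_
    filter_upwards [hm] with x hx
    simp only [eq_iff_iff]
    change x ∈ t ↔ x ∈ ((F.filter (· ∈ t) : Finset α) : Set α)
    simp [hx]
  ext t ht
  rw [key hμ t ht, key hν t ht]
  exact Finset.sum_congr rfl fun x hx => h x (Finset.mem_filter.mp hx).1

/-- Two finite measures on a finite set of points of the plane that have the same moments are equal. -/
lemma measure_eq_of_moments_eq {μ ν : Measure (ℝ × ℝ)} [IsFiniteMeasure μ] [IsFiniteMeasure ν]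
    {F : Finset (ℝ × ℝ)} (hμ : ∀ᵐ p ∂μ, p ∈ F) (hν : ∀ᵐ p ∂ν, p ∈ F)
    (h : ∀ m n : ℕ, ∫ p, p.1 ^ m * p.2 ^ n ∂μ = ∫ p, p.1 ^ m * p.2 ^ n ∂ν) : μ = ν := by
  have int : ∀ {m : Measure (ℝ × ℝ)} [IsFiniteMeasure m], (∀ᵐ p ∂m, p ∈ F) → ∀ f : ℝ × ℝ → ℝ,
      ∫ p, f p ∂m = ∑ p ∈ F, m.real {p} * f p := by
    intro m _ hm f
    have := setIntegral_finset (μ := m) (f := f) F IntegrableOn.finset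
    rwa [Measure.restrict_eq_self_of_ae_mem (s := (F : Set (ℝ × ℝ))) (by simpa using hm)] at this
  simp only [int hμ, int hν] at h
  have poly : ∀ P : MvPolynomial (Fin 2) ℝ, ∑ p ∈ F, μ.real {p} * MvPolynomial.eval ![p.1, p.2] P =
      ∑ p ∈ F, ν.real {p} * MvPolynomial.eval ![p.1, p.2] P := by
    intro P
    have e : ∀ m : Measure (ℝ × ℝ), ∑ p ∈ F, m.real {p} * MvPolynomial.eval ![p.1, p.2] P =
        ∑ d ∈ P.support, P.coeff d * ∑ p ∈ F, m.real {p} * (p.1 ^ d 0 * p.2 ^ d 1) := by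
      intro m
      simp only [MvPolynomial.eval_eq', Finset.mul_sum, Fin.prod_univ_two]
      rw [Finset.sum_comm]
      refine Finset.sum_congr rfl fun d _ => Finset.sum_congr rfl fun p _ => ?_
      simp only [Matrix.cons_val_zero, Matrix.cons_val_one]
      ring
    rw [e, e]
    exact Finset.sum_congr rfl fun d _ => by rw [h]
  refine measure_eq_of_finite_support hμ hν fun p hp => ?_
  -- A product of squared distances to the other points of F is a polynomial that vanishes on F
  -- except at p.
  have hP := poly (∏ q ∈ F.erase p, ((MvPolynomial.X 0 - MvPolynomial.C q.1) ^ 2 +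
    (MvPolynomial.X 1 - MvPolynomial.C q.2) ^ 2))
  simp only [map_prod, map_add, map_pow, map_sub, MvPolynomial.eval_X, MvPolynomial.eval_C,
    Matrix.cons_val_zero, Matrix.cons_val_one] at hP
  have hne : ∀ q ∈ F, q ≠ p →
      ∏ r ∈ F.erase p, ((q.1 - r.1) ^ 2 + (q.2 - r.2) ^ 2) = 0 := fun q hq hqp =>
    Finset.prod_eq_zero (Finset.mem_erase.mpr ⟨hqp, hq⟩) (by ring)
  have hpp : ∏ r ∈ F.erase p, ((p.1 - r.1) ^ 2 + (p.2 - r.2) ^ 2) ≠ 0 := by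
    refine Finset.prod_ne_zero_iff.mpr fun r hr h0 => (Finset.mem_erase.mp hr).1 ?_
    have h1 : p.1 - r.1 = 0 := by nlinarith [sq_nonneg (p.1 - r.1), sq_nonneg (p.2 - r.2)]
    have h2 : p.2 - r.2 = 0 := by nlinarith [sq_nonneg (p.1 - r.1), sq_nonneg (p.2 - r.2)]
    exact Prod.ext (by linarith) (by linarith)
  rw [Finset.sum_eq_single_of_mem p hp fun q hq hqp => by rw [hne q hq hqp, mul_zero],
    Finset.sum_eq_single_of_mem p hp fun q hq hqp => by rw [hne q hq hqp, mul_zero]] at hP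
  have := mul_right_cancel₀ hpp hP
  rwa [measureReal_def, measureReal_def, ENNReal.toReal_eq_toReal_iff' (measure_ne_top _ _)
    (measure_ne_top _ _)] at this

section Uniqueness

variable {H : Type*} [NormedAddCommGroup H] [InnerProductSpace ℂ H] [FiniteDimensional ℂ H]
  [CompleteSpace H] {a b : H →L[ℂ] H} {Ω : H}

lemma IsJointSpectralMeasure.unique (hfin : (jointSpectrum a b).Finite) {μ ν : Measure (ℝ × ℝ)}
    (hμ : IsJointSpectralMeasure a b Ω μ) (hν : IsJointSpectralMeasure a b Ω ν) : μ = ν := by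
  have := hμ.isProbability
  have := hν.isProbability
  refine measure_eq_of_moments_eq (F := hfin.toFinset) (by simpa using hμ.supported)
    (by simpa using hν.supported) fun m n => ?_
  exact_mod_cast (hμ.moments m n).symm.trans (hν.moments m n)

/-- Both coordinates of a point in the fibre are, up to inversion, among the three eigenvalues of ω.
-/
lemma finite_fiber_chi (ω : Circle × Circle) :
    {ω' : Circle × Circle | chi₁ ω = chi₁ ω' ∧ chi₂ ω = chi₂ ω'}.Finite := by
  have hfin : ({ω.1, ω.2⁻¹, (ω.1 * ω.2⁻¹)⁻¹} : Set Circle).Finite := by simp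
  refine ((hfin.union hfin.inv).prod (hfin.union hfin.inv)).subset ?_
  rintro ω' ⟨h1, h2⟩
  simp only [Set.mem_prod, Set.mem_union, Set.mem_inv, Set.mem_insert_iff, Set.mem_singleton_iff]
  rcases tripleSum_eq_or_of_chi_eq h1 h2 with h | h
  · have := circle_triple_of_sum_eq h
    tauto
  · have := circle_triple_of_sum_eq h
    simp only [inv_inv] at this
    tauto

lemma measure_singleton_torusAction {ε : Measure (Circle × Circle)} {g : GL (Fin 2) ℤ}
    (h : ε.map (torusAction g) = ε) (ω : Circle × Circle) : ε {torusAction g ω} = ε {ω} := by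
  rw [← h, Measure.map_apply (measurable_torusAction g) (measurableSet_singleton _), h]
  congr 1
  ext ω'
  simp only [Set.mem_preimage, Set.mem_singleton_iff]
  constructor
  · intro e
    have := congrArg (torusAction g⁻¹) e
    rwa [torusAction_inv_apply, torusAction_inv_apply] at this
  · rintro rfl
    rfl

/-- Invariance gives all points of a fibre of the characters the same mass, since the fibre is one
orbit. The mass of a point is thus the mass of its image divided by the size of the fibre, and the
image measure is determined by its moments. -/
lemma IsJointSpectralMeasureOverTorus.unique (hfin : (jointSpectrum a b).Finite)
    {μ ν : Measure (Circle × Circle)} (hμ : IsJointSpectralMeasureOverTorus a b Ω μ)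
    (hν : IsJointSpectralMeasureOverTorus a b Ω ν) : μ = ν := by
  have hmap := hμ.pushforward.unique hfin hν.pushforward
  have hE : ((fun ω => (chi₁ ω, chi₂ ω)) ⁻¹' jointSpectrum a b).Finite := by
    refine hfin.preimage' fun p _ => ?_
    by_cases hp : ∃ ω, (chi₁ ω, chi₂ ω) = p
    · obtain ⟨ω, rfl⟩ := hp
      refine (finite_fiber_chi ω).subset fun ω' h => ?_
      simp only [Set.mem_preimage, Set.mem_singleton_iff, Prod.mk.injEq] at h
      exact ⟨h.1.symm, h.2.symm⟩
    · refine Set.finite_empty.subset fun ω h => hp ⟨ω, h⟩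
  have hsupp : ∀ {ε : Measure (Circle × Circle)}, IsJointSpectralMeasureOverTorus a b Ω ε →
      ∀ᵐ ω ∂ε, ω ∈ hE.toFinset := by
    intro ε hε
    have := ae_of_ae_map measurable_chi.aemeasurable hε.pushforward.supported
    simpa using this
  have hfib : ∀ {ε : Measure (Circle × Circle)}, IsJointSpectralMeasureOverTorus a b Ω ε →
      ∀ ω, (ε.map fun ω => (chi₁ ω, chi₂ ω)) {(chi₁ ω, chi₂ ω)} =
        (finite_fiber_chi ω).toFinset.card * ε {ω} := by
    intro ε hε ω
    rw [Measure.map_apply measurable_chi (measurableSet_singleton _), ← nsmul_eq_mul,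
      ← Finset.sum_const]
    have : (fun ω => (chi₁ ω, chi₂ ω)) ⁻¹' {(chi₁ ω, chi₂ ω)} =
        ((finite_fiber_chi ω).toFinset : Set (Circle × Circle)) := by
      ext ω'
      simp [eq_comm]
    rw [this, ← sum_measure_singleton]
    refine Finset.sum_congr rfl fun ω' h => ?_
    simp only [Set.Finite.mem_toFinset, Set.mem_ofPred_eq] at h
    obtain ⟨g, hg, rfl⟩ := weylRel_of_chi_eq h.1 h.2
    exact measure_singleton_torusAction (hε.invariant g hg) ω
  refine measure_eq_of_finite_support (hsupp hμ) (hsupp hν) fun ω _ => ?_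
  have h := (hfib hμ ω).symm.trans ((congrFun (congrArg _ hmap) _).trans (hfib hν ω))
  refine (ENNReal.mul_right_inj ?_ (ENNReal.natCast_ne_top _)).mp h
  rw [Nat.cast_ne_zero, Finset.card_ne_zero]
  exact ⟨ω, by simp⟩

end Uniqueness

/-! ### The adjacency operators -/

/-- The complex `S`-matrix. -/
noncomputable def complexSMatrix (k : ℕ) : Matrix (alcove k) (alcove k) ℂ :=
  (sMatrix k).map ((↑) : ℝ → ℂ)

lemma complexSMatrix_mul_self {k : ℕ} (hk : 1 ≤ k) : complexSMatrix k * complexSMatrix k = 1 := by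
  have h := congrArg (Complex.ofRealHom.mapMatrix) (sMatrix_mul_self hk)
  rwa [map_mul, map_one] at h

lemma map_natCast_complex_eq {k : ℕ} {A : Matrix (alcove k) (alcove k) ℕ} {d : alcove k → ℝ}
    (h : A.map (fun n : ℕ => (n : ℝ)) = sMatrix k * Matrix.diagonal d * sMatrix k) :
    A.map (fun n : ℕ => (n : ℂ)) =
      complexSMatrix k * Matrix.diagonal (fun x => (d x : ℂ)) * complexSMatrix k := by
  have h' := congrArg (Complex.ofRealHom.mapMatrix) h
  rw [map_mul, map_mul] at h'
  have e1 : Complex.ofRealHom.mapMatrix (A.map fun n : ℕ => (n : ℝ)) =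
      A.map (fun n : ℕ => (n : ℂ)) := by ext; simp
  have e2 : Complex.ofRealHom.mapMatrix (Matrix.diagonal d) =
      Matrix.diagonal (fun x => (d x : ℂ)) := by
    ext i j
    by_cases hij : i = j
    · subst hij; simp
    · simp [Matrix.diagonal_apply_ne _ hij]
  rw [e1, e2] at h'
  exact h'

lemma isSelfAdjoint_adjacencyOperator {V : Type*} [Fintype V] [DecidableEq V] {A : Matrix V V ℕ}
    (h : ∀ x y, A x y = A y x) : IsSelfAdjoint (adjacencyOperator A) := by
  refine IsSelfAdjoint.map (x := A.map fun n : ℕ => (n : ℂ)) ?_ Matrix.toEuclideanCLM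
  ext x y
  simp [Matrix.star_apply, h x y]

lemma conj_diagonal_mul {ι : Type*} [Fintype ι] [DecidableEq ι] {S : Matrix ι ι ℂ} (hS : S * S = 1)
    (c d : ι → ℂ) : (S * Matrix.diagonal c * S) * (S * Matrix.diagonal d * S) =
      S * Matrix.diagonal (c * d) * S := by
  calc _ = S * Matrix.diagonal c * (S * S) * Matrix.diagonal d * S := by simp only [Matrix.mul_assoc]
    _ = _ := by
      rw [hS, Matrix.mul_one, Matrix.mul_assoc S, Matrix.diagonal_mul_diagonal]
      rfl

lemma conj_diagonal_pow {ι : Type*} [Fintype ι] [DecidableEq ι] {S : Matrix ι ι ℂ} (hS : S * S = 1)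
    (c : ι → ℂ) (m : ℕ) : (S * Matrix.diagonal c * S) ^ m = S * Matrix.diagonal (c ^ m) * S := by
  induction m with
  | zero => rw [pow_zero, pow_zero, Matrix.diagonal_one', Matrix.mul_one, hS]
  | succ m ih => rw [pow_succ, ih, conj_diagonal_mul hS, pow_succ]

lemma commute_adjacencyOperator {k : ℕ} (hk : 1 ≤ k) :
    Commute (adjacencyOperator (fusionGraph₁ k)) (adjacencyOperator (fusionGraph₂ k)) := by
  refine Commute.map (f := Matrix.toEuclideanCLM) ?_
  rw [map_natCast_complex_eq (fusionGraph₁_eq hk), map_natCast_complex_eq (fusionGraph₂_eq hk),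
    commute_iff_eq, conj_diagonal_mul (complexSMatrix_mul_self hk),
    conj_diagonal_mul (complexSMatrix_mul_self hk), mul_comm]

/-- With S² = 1 the operator is S D S for a diagonal D, and its vacuum entry weights the eigenvalue
at x by S_{x,0}². -/
lemma inner_vacuum_moment {k : ℕ} (hk : 1 ≤ k) (m n : ℕ) :
    inner ℂ (EuclideanSpace.single (vacuum k) (1 : ℂ)) ((adjacencyOperator (fusionGraph₁ k) ^ m *
      adjacencyOperator (fusionGraph₂ k) ^ n) (EuclideanSpace.single (vacuum k) (1 : ℂ))) =
    ((∑ x : alcove k, kacPetersonS k x (0, 0) ^ 2 *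
      (eigenvalue₁ k x ^ m * eigenvalue₂ k x ^ n) : ℝ) : ℂ) := by
  have hS := complexSMatrix_mul_self hk
  rw [adjacencyOperator, adjacencyOperator, ← map_pow, ← map_pow, ← map_mul,
    map_natCast_complex_eq (fusionGraph₁_eq hk), map_natCast_complex_eq (fusionGraph₂_eq hk),
    conj_diagonal_pow hS, conj_diagonal_pow hS, conj_diagonal_mul hS,
    EuclideanSpace.inner_single_left, Matrix.ofLp_toEuclideanCLM]
  simp only [map_one, one_mul, PiLp.ofLp_single, Matrix.mulVec_single_one]
  rw [Matrix.col_apply, Matrix.mul_apply, Complex.ofReal_sum]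
  refine Finset.sum_congr rfl fun x _ => ?_
  have e1 : complexSMatrix k x (vacuum k) = (kacPetersonS k x (0, 0) : ℂ) := rfl
  have e2 : complexSMatrix k (vacuum k) x = (kacPetersonS k x (0, 0) : ℂ) := by
    rw [kacPetersonS_comm]; rfl
  rw [Matrix.mul_diagonal, e1, e2, Pi.mul_apply, Pi.pow_apply, Pi.pow_apply]
  push_cast
  ring

/-- The joint spectrum of the two adjacency operators. -/
lemma jointSpectrum_adjacencyOperator {k : ℕ} (hk : 1 ≤ k) :
    jointSpectrum (adjacencyOperator (fusionGraph₁ k)) (adjacencyOperator (fusionGraph₂ k)) =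
      Set.range fun x : alcove k => (eigenvalue₁ k x, eigenvalue₂ k x) := by
  have hS := complexSMatrix_mul_self hk
  have hA := map_natCast_complex_eq (fusionGraph₁_eq hk)
  have hB := map_natCast_complex_eq (fusionGraph₂_eq hk)
  ext p
  simp only [jointSpectrum, Set.mem_ofPred_eq, Set.mem_range, adjacencyOperator, hA, hB]
  constructor
  · rintro ⟨v, hv, h1, h2⟩
    have key : ∀ {d : alcove k → ℂ} {c : ℂ}, Matrix.toEuclideanCLM (𝕜 := ℂ)
        (complexSMatrix k * Matrix.diagonal d * complexSMatrix k) v = c • v →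
        ∀ x, d x * (complexSMatrix k).mulVec v.ofLp x = c * (complexSMatrix k).mulVec v.ofLp x := by
      intro d c h x
      have h' := congrArg (fun w => (complexSMatrix k).mulVec w.ofLp) h
      simp only [Matrix.ofLp_toEuclideanCLM, Matrix.mulVec_mulVec] at h'
      rw [← Matrix.mul_assoc, ← Matrix.mul_assoc, hS, Matrix.one_mul, ← Matrix.mulVec_mulVec] at h'
      have := congrFun h' x
      rw [Matrix.mulVec_diagonal] at this
      rw [this, WithLp.ofLp_smul, Matrix.mulVec_smul]
      rfl
    have hne : (complexSMatrix k).mulVec v.ofLp ≠ 0 := by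
      intro h0
      have : (complexSMatrix k).mulVec ((complexSMatrix k).mulVec v.ofLp) = 0 := by
        rw [h0, Matrix.mulVec_zero]
      rw [Matrix.mulVec_mulVec, hS, Matrix.one_mulVec] at this
      exact hv (by ext i; exact congrFun this i)
    obtain ⟨x, hx⟩ := Function.ne_iff.mp hne
    refine ⟨x, Prod.ext ?_ ?_⟩
    · exact_mod_cast mul_right_cancel₀ hx (key h1 x)
    · exact_mod_cast mul_right_cancel₀ hx (key h2 x)
  · rintro ⟨x, rfl⟩
    have key : ∀ d : alcove k → ℂ, Matrix.toEuclideanCLM (𝕜 := ℂ)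
        (complexSMatrix k * Matrix.diagonal d * complexSMatrix k)
        (WithLp.toLp 2 ((complexSMatrix k).mulVec (Pi.single x 1))) =
        d x • WithLp.toLp 2 ((complexSMatrix k).mulVec (Pi.single x 1)) := by
      intro d
      rw [Matrix.toEuclideanCLM_toLp, Matrix.mulVec_mulVec, Matrix.mul_assoc, hS, Matrix.mul_one,
        ← Matrix.mulVec_mulVec, ← WithLp.toLp_smul, ← Matrix.mulVec_smul]
      congr 2
      ext i
      by_cases hi : i = x
      · subst hi; simp [Matrix.mulVec_diagonal]
      · simp [Matrix.mulVec_diagonal, Pi.single_eq_of_ne hi]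
    refine ⟨_, ?_, key _, key _⟩
    intro h0
    have h1 : (complexSMatrix k).mulVec (Pi.single x 1) = 0 := congrArg WithLp.ofLp h0
    have h2 : (complexSMatrix k).mulVec ((complexSMatrix k).mulVec (Pi.single x 1)) = 0 := by
      rw [h1, Matrix.mulVec_zero]
    rw [Matrix.mulVec_mulVec, hS, Matrix.one_mulVec] at h2
    simpa using congrFun h2 x

/-! ### The discrete measure -/

lemma card_grid (k : ℕ) : (grid k).card = 3 * (k + 4) ^ 2 := by
  have h := sum_grid_eq k (fun _ => 1)
  simp only [Finset.sum_const, Int.card_Ico, smul_eq_mul, mul_one] at h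
  rw [h, show (3 * ((k : ℤ) + 4) - 0).toNat = 3 * (k + 4) by omega,
    show ((k : ℤ) + 4 - 0).toNat = k + 4 by omega]
  ring

open scoped Classical in
/-- The set `torusPoints k` as a `Finset`. -/
noncomputable def torusFinset (k : ℕ) : Finset (Circle × Circle) := (grid k).image (gridPoint k)

open scoped Classical in
lemma coe_torusFinset (k : ℕ) : (torusFinset k : Set (Circle × Circle)) = torusPoints k := by
  rw [torusFinset, torusPoints_eq_image, Finset.coe_image]

open scoped Classical in
lemma card_torusFinset (k : ℕ) : (torusFinset k).card = 3 * (k + 4) ^ 2 := by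
  rw [torusFinset, Finset.card_image_of_injOn (gridPoint_injOn k), card_grid]

open scoped Classical in
lemma sum_torusFinset {M : Type*} [AddCommMonoid M] (k : ℕ) (H : Circle × Circle → M) :
    ∑ ω ∈ torusFinset k, H ω = ∑ q ∈ grid k, H (gridPoint k q) :=
  Finset.sum_image (gridPoint_injOn k)

-- Dropping the bounds on the exponents exhibits the set as a subgroup of the torus, so that
-- invariance under the Weyl generators needs only the congruence modulo 3.
open scoped Classical in
lemma mem_torusFinset {k : ℕ} {ω : Circle × Circle} :
    ω ∈ torusFinset k ↔ ∃ a b : ℤ, 3 ∣ a + b ∧ ω = gridPoint k (a, b) := by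
  simp only [torusFinset, Finset.mem_image, mem_grid]
  constructor
  · rintro ⟨⟨a, b⟩, ⟨-, -, -, -, h⟩, rfl⟩
    exact ⟨a, b, h, rfl⟩
  · rintro ⟨a, b, ⟨c, hc⟩, rfl⟩
    refine ⟨(a % (3 * (k + 4)), b % (3 * (k + 4))), ⟨Int.emod_nonneg _ (by omega),
      Int.emod_lt_of_pos _ (by omega), Int.emod_nonneg _ (by omega),
      Int.emod_lt_of_pos _ (by omega), ?_⟩, ?_⟩
    · simp only [Int.emod_def]
      exact ⟨c - (k + 4) * (a / (3 * (k + 4))) - (k + 4) * (b / (3 * (k + 4))), by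
        linear_combination hc⟩
    · simp only [gridPoint, Prod.mk.injEq]
      constructor
      · rw [circleAt_div_eq_iff]
        exact ⟨-(a / (3 * (k + 4))), by rw [Int.emod_def]; ring⟩
      · rw [circleAt_div_eq_iff]
        exact ⟨-(b / (3 * (k + 4))), by rw [Int.emod_def]; ring⟩

/-! ### Invariance of the measure and its image under the characters -/

lemma discreteMeasure_apply (k : ℕ) {t : Set (Circle × Circle)} (ht : MeasurableSet t) :
    discreteMeasure k t = ((3 * (k + 4) ^ 2 : ℕ) : ENNReal)⁻¹ * ∑ ω ∈ torusFinset k,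
      t.indicator (fun ω => ENNReal.ofReal (jacobian ω ^ 2 / (192 * Real.pi ^ 4))) ω := by
  rw [discreteMeasure, withDensity_apply _ ht, ← lintegral_indicator ht, uniformOn, ProbabilityTheory.cond,
    lintegral_smul_measure, smul_eq_mul, ← coe_torusFinset, Measure.count_apply_finset,
    card_torusFinset, lintegral_finset]
  simp only [Measure.count_singleton, mul_one]

lemma map_discreteMeasure (k : ℕ) {e : Circle × Circle → Circle × Circle} (he : Measurable e)
    (inj : Function.Injective e) (maps : ∀ ω ∈ torusFinset k, e ω ∈ torusFinset k)
    (hj : ∀ ω, jacobian (e ω) ^ 2 = jacobian ω ^ 2) :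
    (discreteMeasure k).map e = discreteMeasure k := by
  ext t ht
  rw [Measure.map_apply he ht, discreteMeasure_apply k ht, discreteMeasure_apply k (he ht)]
  congr 1
  refine Finset.sum_nbij e maps inj.injOn
    (Finset.surjOn_of_injOn_of_card_le e maps inj.injOn le_rfl) fun ω _ => ?_
  by_cases h : e ω ∈ t
  · rw [Set.indicator_of_mem h, Set.indicator_of_mem (Set.mem_preimage.mpr h), hj]
  · rw [Set.indicator_of_notMem h, Set.indicator_of_notMem (by exact h)]

lemma map_torusAction_discreteMeasure (k : ℕ) {g : GL (Fin 2) ℤ} (hg : g ∈ weylGroup) :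
    (discreteMeasure k).map (torusAction g) = discreteMeasure k := by
  have inj : ∀ g, Function.Injective (torusAction g) := fun g =>
    Function.LeftInverse.injective (torusAction_inv_apply g)
  refine weylGroup_induction (p := fun g => (discreteMeasure k).map (torusAction g) =
    discreteMeasure k) ?_ ?_ ?_ ?_ ?_ hg
  · have : torusAction 1 = id := funext torusAction_one
    simp only [this, Measure.map_id]
  · intro g h hg hh
    have : torusAction (g * h) = torusAction g ∘ torusAction h := funext (torusAction_mul g h)
    rw [this, ← Measure.map_map (measurable_torusAction g) (measurable_torusAction h), hh, hg]
  · intro g hg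
    have : torusAction g⁻¹ ∘ torusAction g = id := funext (torusAction_inv_apply g)
    nth_rewrite 1 [← hg]
    rw [Measure.map_map (measurable_torusAction _) (measurable_torusAction _), this, Measure.map_id]
  · intro g hg
    refine map_discreteMeasure k (measurable_torusAction g) (inj g) (fun ω h => ?_) fun ω => ?_
    · obtain ⟨a, b, h, rfl⟩ := mem_torusFinset.mp h
      refine mem_torusFinset.mpr ⟨-b, -a, by omega, ?_⟩
      simp only [gridPoint, hg, ← circleAt_neg]
      push_cast
      simp only [neg_div]
    · rw [← Prod.mk.eta (p := ω), hg, jacobian_swap, neg_sq]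
  · intro g hg
    refine map_discreteMeasure k (measurable_torusAction g) (inj g) (fun ω h => ?_) fun ω => ?_
    · obtain ⟨a, b, h, rfl⟩ := mem_torusFinset.mp h
      refine mem_torusFinset.mpr ⟨b, b - a, by omega, ?_⟩
      simp only [gridPoint, hg, ← circleAt_neg, ← circleAt_add]
      push_cast
      simp only [sub_div, neg_add_eq_sub]
    · rw [← Prod.mk.eta (p := ω), hg, jacobian_rotate]

/-- The image of the discrete measure under the characters. -/
lemma map_chi_discreteMeasure (k : ℕ) : (discreteMeasure k).map (fun ω => (chi₁ ω, chi₂ ω)) =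
    ∑ x : alcove k, ENNReal.ofReal (kacPetersonS k x (0, 0) ^ 2) •
      Measure.dirac (eigenvalue₁ k x, eigenvalue₂ k x) := by
  classical
  ext t ht
  rw [Measure.map_apply measurable_chi ht, discreteMeasure_apply k (measurable_chi ht),
    sum_torusFinset, sum_grid_eq_nsmul_sum_alcove, Measure.finsetSum_apply]
  · rw [← Finset.sum_coe_sort, nsmul_eq_mul, Finset.mul_sum, Finset.mul_sum]
    refine Finset.sum_congr rfl fun x _ => ?_
    rw [Measure.smul_apply, Measure.dirac_apply' _ ht, smul_eq_mul, kacPetersonS_zero_sq]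
    simp only [Set.indicator_apply, Set.mem_preimage, eigenvalue₁, eigenvalue₂, Pi.one_apply]
    split_ifs
    -- The constants agree because 12 / (3(k+4)² · 192π⁴) = 1 / (48(k+4)²π⁴).
    · rw [mul_one]
      rw [← ENNReal.ofReal_natCast, ← ENNReal.ofReal_natCast,
        ← ENNReal.ofReal_inv_of_pos (by positivity), ← ENNReal.ofReal_mul (by positivity),
        ← ENNReal.ofReal_mul (by positivity)]
      congr 1
      push_cast
      field_simp
      ring
    · simp
  · intro a b
    simp only [Set.indicator_apply, Set.mem_preimage, chi₁_swap, chi₂_swap, jacobian_swap, neg_sq]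
  · intro a b
    simp only [Set.indicator_apply, Set.mem_preimage, chi₁_rotate, chi₂_rotate, jacobian_rotate]
  · intro ω h
    simp [Set.indicator_apply, h]

lemma isJointSpectralMeasureOverTorus_discreteMeasure {k : ℕ} (hk : 1 ≤ k) :
    IsJointSpectralMeasureOverTorus (adjacencyOperator (fusionGraph₁ k))
      (adjacencyOperator (fusionGraph₂ k)) (EuclideanSpace.single (vacuum k) (1 : ℂ))
      (discreteMeasure k) where
  invariant g hg := map_torusAction_discreteMeasure k hg
  pushforward := by
    rw [map_chi_discreteMeasure]
    refine ⟨isSelfAdjoint_adjacencyOperator (fusionGraph₁_comm k),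
      isSelfAdjoint_adjacencyOperator (fusionGraph₂_comm k), commute_adjacencyOperator hk, by simp,
      ⟨?_⟩, ?_, fun m n => ?_⟩
    · rw [Measure.finsetSum_apply]
      simp only [Measure.smul_apply, measure_univ, smul_eq_mul, mul_one]
      rw [← ENNReal.ofReal_sum_of_nonneg (fun _ _ => sq_nonneg _), sum_kacPetersonS_zero_sq,
        ENNReal.ofReal_one]
    · have hmeas : MeasurableSet (jointSpectrum (adjacencyOperator (fusionGraph₁ k))
          (adjacencyOperator (fusionGraph₂ k))) := by
        rw [jointSpectrum_adjacencyOperator hk]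
        exact (Set.finite_range _).measurableSet
      rw [ae_iff, Measure.finsetSum_apply]
      refine Finset.sum_eq_zero fun x _ => ?_
      have hx : (eigenvalue₁ k x, eigenvalue₂ k x) ∈ jointSpectrum
          (adjacencyOperator (fusionGraph₁ k)) (adjacencyOperator (fusionGraph₂ k)) := by
        rw [jointSpectrum_adjacencyOperator hk]
        exact ⟨x, rfl⟩
      rw [Measure.smul_apply, ← Set.compl_def, Measure.dirac_apply' _ hmeas.compl]
      simp [hx]
    · rw [inner_vacuum_moment hk, integral_finsetSum_measure]
      · congr 1
        refine Finset.sum_congr rfl fun x _ => ?_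
        rw [integral_smul_measure, integral_dirac, ENNReal.toReal_ofReal (sq_nonneg _), smul_eq_mul]
      · intro x _
        exact Integrable.smul_measure (integrable_dirac enorm_lt_top) ENNReal.ofReal_ne_top

theorem theorem3 (k : ℕ) (hk : 1 ≤ k) :
    -- the joint spectral measure over the torus exists, is unique, and is the stated measure
    (∀ ε : Measure (Circle × Circle),
      IsJointSpectralMeasureOverTorus (adjacencyOperator (fusionGraph₁ k))
          (adjacencyOperator (fusionGraph₂ k)) (EuclideanSpace.single (vacuum k) (1 : ℂ)) ε ↔
        ε = discreteMeasure k) ∧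
    -- the number of points that carry the uniform measure
    (torusPoints k).ncard = 3 * (k + 4) ^ 2 ∧
    -- `J` is, up to sign, the Jacobian of the two characters, and a product of six sines
    (∀ θ₁ θ₂ : ℝ,
      jacobian (circleAt θ₁, circleAt θ₂) = -(Matrix.det
        !![deriv (fun t => chi₁ (circleAt t, circleAt θ₂)) θ₁,
           deriv (fun t => chi₁ (circleAt θ₁, circleAt t)) θ₂;
           deriv (fun t => chi₂ (circleAt t, circleAt θ₂)) θ₁,
           deriv (fun t => chi₂ (circleAt θ₁, circleAt t)) θ₂]) ∧
      jacobian (circleAt θ₁, circleAt θ₂) = 256 * Real.pi ^ 2 *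
        (Real.sin (Real.pi * θ₁) * Real.sin (Real.pi * θ₂) * Real.sin (Real.pi * (θ₁ + θ₂)) *
          Real.sin (Real.pi * (θ₁ - θ₂)) * Real.sin (Real.pi * (2 * θ₁ - θ₂)) *
          Real.sin (Real.pi * (θ₁ - 2 * θ₂)))) ∧
    -- the graphs are the fusion graphs: the orthogonal `S`-matrix diagonalises them
    sMatrix k * (sMatrix k).transpose = 1 ∧
    (fusionGraph₁ k).map (fun n : ℕ => (n : ℝ)) = verlindeMatrix k (1, 0) ∧
    (fusionGraph₂ k).map (fun n : ℕ => (n : ℝ)) = verlindeMatrix k (0, 1) ∧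
    -- the entries of the eigenvectors at the distinguished vertex are values of `J`
    (∀ l : alcove k,
      sMatrix k l (vacuum k) = -1 / (4 * Real.sqrt 3 * (k + 4) * Real.pi ^ 2) *
        jacobian (circleAt (((l.1.1 + 1) + 3 * (l.1.2 + 1)) / (3 * (k + 4))),
          circleAt (-(l.1.1 + 1) / (3 * (k + 4))))) := by
  refine ⟨fun ε => ⟨fun h => ?_, ?_⟩, ?_, fun θ₁ θ₂ => ⟨jacobian_eq_neg_det θ₁ θ₂,
    jacobian_eq_prod_sin θ₁ θ₂⟩, ?_, fusionGraph₁_eq_verlindeMatrix hk,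
    fusionGraph₂_eq_verlindeMatrix hk, fun l => ?_⟩
  · refine h.unique ?_ (isJointSpectralMeasureOverTorus_discreteMeasure hk)
    rw [jointSpectrum_adjacencyOperator hk]
    exact Set.finite_range _
  · rintro rfl
    exact isJointSpectralMeasureOverTorus_discreteMeasure hk
  · rw [← coe_torusFinset, Set.ncard_coe_finset, card_torusFinset]
  · rw [sMatrix_transpose, sMatrix_mul_self hk]
  · refine (kacPetersonS_zero k l).trans ?_
    simp only [weightPoint, shifted]
    push_cast
    rfl
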